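/- For an additive abelian group $G$, let $\mathcal B(G)$ be the monoid of zero-sum sequences over $G$, that is, the submonoid of the free abelian monoid with basis $G$ consisting of all finite (unordered) sequences $g_1\cdots g_\ell$ with $g_1+\dots+g_\ell=0$. An atom of $\mathcal B(G)$ is a non-unit that is not a product of two non-units. For a non-unit $A\in\mathcal B(G)$ let $\mathsf L(A)$ be the set of all $k\in\mathbb N$ such that $A$ is a product of $k$ atoms, and let $\mathsf L(A)=\{0\}$ if $A$ is the empty sequence (the only unit); put $\mathcal L(G)=\{\mathsf L(A)\mid A\in\mathcal B(G)\}$. Write $\mathbb N=\{1,2,\dots\}$, $\mathbb N_0=\mathbb N\cup\{0\}$, $[a,b]=\{x\in\mathbb Z\mid a\le x\le b\}$, $y+L=\{y+x\mid x\in L\}$ and $2\cdot L=\{2x\mid x\in L\}$. Let $C_n$ be the cyclic group of order $n$. Then $$\mathcal L(C_2\oplus C_4)=\mathcal L_1\cup\mathcal L_2\cup\mathcal L_3\cup\mathcal L_4\cup\mathcal L_5,$$ where \begin{align*} \mathcal L_1&=\{\{y\}\mid y\in\mathbb N_0\},\\ \mathcal L_2&=\{y+2\lceil k/3\rceil+[0,k]\mid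 y\in\mathbb N_0,\ k\in\mathbb N\setminus\{3\}\}\cup\{y+[3,6]\mid y\in\mathbb N_0\}\cup\{[2t+1,5t+2]\mid t\in\mathbb N\}\\ &=\{y+\lceil 2k/3\rceil+[0,k]\mid y\in\mathbb N_0,\ k\in\mathbb N\setminus\{1,3\}\}\cup\{y+3+[0,3],\ y+2+[0,1]\mid y\in\mathbb N_0\},\\ \mathcal L_3&=\{y+2k+2\cdot[0,k]\mid y\in\mathbb N_0,\ k\in\mathbb N\},\\ \mathcal L_4&=\{y+k+1+(\{0\}\cup[2,k+2])\mid y\in\mathbb N_0,\ k\in\mathbb N\text{ odd}\},\\ \mathcal L_5&=\{y+k+2+([0,k]\cup\{k+2\})\mid y\in\mathbb N_0,\ k\in\mathbb N\}. \end{align*} (The equality of the two descriptions of $\mathcal L_2$ is part of the claim.) -/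

import Mathlib

/-- The monoid `𝓑(G)` of zero-sum sequences over an (additive) abelian group `G`: the submonoid
of the free abelian monoid `Multiset G` consisting of the sequences whose terms sum to `0`. -/
def zeroSumMonoid (G : Type*) [AddCommGroup G] : AddSubmonoid (Multiset G) where
  carrier := {S | S.sum = 0}
  zero_mem' := Multiset.sum_zero
  add_mem' := fun {S T} hS hT => by
    have hS' : S.sum = 0 := hS
    have hT' : T.sum = 0 := hT
    change (S + T).sum = 0
    rw [Multiset.sum_add, hS', hT', add_zero]

/-- The set of lengths `𝖫(a)` of an element `a` of a commutative (additively written) monoid: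
all `k` such that `a` is a sum of `k` atoms if `a` is not a unit, and `{0}` if `a` is a unit. -/
def setOfLengths {H : Type*} [AddCommMonoid H] (a : H) : Set ℕ :=
  {k | (IsAddUnit a ∧ k = 0) ∨
    (¬ IsAddUnit a ∧ ∃ s : Multiset H, (∀ u ∈ s, AddIrreducible u) ∧ s.sum = a ∧ s.card = k)}

/-- The system of sets of lengths `𝓛(H) = {𝖫(a) ∣ a ∈ H}` of a commutative monoid `H`. -/
def systemOfSetsOfLengths (H : Type*) [AddCommMonoid H] : Set (Set ℕ) :=
  {L | ∃ a : H, L = setOfLengths a}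

/-- `𝓛(G) = 𝓛(𝓑(G))` for an abelian group `G`. -/
def groupSystemOfSetsOfLengths (G : Type*) [AddCommGroup G] : Set (Set ℕ) :=
  systemOfSetsOfLengths (zeroSumMonoid G)

/-- The shifted set `y + L`. -/
def shift (y : ℕ) (L : Set ℕ) : Set ℕ := (fun x => y + x) '' L

/-- The dilated set `m · L = {m x ∣ x ∈ L}`. -/
def dilate (m : ℕ) (L : Set ℕ) : Set ℕ := (fun x => m * x) '' L

/-- `{ {y} ∣ y ∈ ℕ₀ }`. -/
def family1 : Set (Set ℕ) := {L | ∃ y : ℕ, L = {y}}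

/-- `{ y + 2⌈k/3⌉ + [0,k] ∣ y ∈ ℕ₀, k ∈ ℕ ∖ {3} } ∪ { y + [3,6] ∣ y ∈ ℕ₀ }
∪ { [2t+1, 5t+2] ∣ t ∈ ℕ }`. -/
def family2 : Set (Set ℕ) :=
  {L | ∃ y k : ℕ, 1 ≤ k ∧ k ≠ 3 ∧ L = shift (y + 2 * ⌈(k : ℚ) / 3⌉₊) (Set.Icc 0 k)} ∪
  {L | ∃ y : ℕ, L = shift y (Set.Icc 3 6)} ∪
  {L | ∃ t : ℕ, 1 ≤ t ∧ L = Set.Icc (2 * t + 1) (5 * t + 2)}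

/-- `{ y + ⌈2k/3⌉ + [0,k] ∣ y ∈ ℕ₀, k ∈ ℕ ∖ {1,3} } ∪ { y + 3 + [0,3], y + 2 + [0,1] ∣ y ∈ ℕ₀ }`. -/
def family2' : Set (Set ℕ) :=
  {L | ∃ y k : ℕ, 1 ≤ k ∧ k ≠ 1 ∧ k ≠ 3 ∧ L = shift (y + ⌈(2 * k : ℚ) / 3⌉₊) (Set.Icc 0 k)} ∪
  {L | ∃ y : ℕ, L = shift (y + 3) (Set.Icc 0 3) ∨ L = shift (y + 2) (Set.Icc 0 1)}

/-- `{ y + 2k + 2 · [0,k] ∣ y ∈ ℕ₀, k ∈ ℕ }`. -/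
def family3 : Set (Set ℕ) :=
  {L | ∃ y k : ℕ, 1 ≤ k ∧ L = shift (y + 2 * k) (dilate 2 (Set.Icc 0 k))}

/-- `{ y + k + 1 + ({0} ∪ [2,k+2]) ∣ y ∈ ℕ₀, k ∈ ℕ odd }`. -/
def family4 : Set (Set ℕ) :=
  {L | ∃ y k : ℕ, Odd k ∧ L = shift (y + k + 1) ({0} ∪ Set.Icc 2 (k + 2))}

/-- `{ y + k + 2 + ([0,k] ∪ {k+2}) ∣ y ∈ ℕ₀, k ∈ ℕ }`. -/
def family5 : Set (Set ℕ) :=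
  {L | ∃ y k : ℕ, 1 ≤ k ∧ L = shift (y + k + 2) (Set.Icc 0 k ∪ {k + 2})}

/-! There are 39 atoms: the sequence `0` and 38 atoms with between two and five terms. Counting the
terms of a sequence, with `0` counted twice, bounds every length `l` by `2 * l ≤ w ≤ 5 * l`, so the
maximum of a set of lengths is at most 5/2 times its minimum. The real question is where a set of
lengths can have gaps.

Let `Z` be a factorization of length `k` such that `k + 1` is not a length. Then no subfamily of `Z`
can be exchanged for a family with the same sum and one more atom. The tables list enough exchanges
that an exhaustive search, run by the kernel, forces every family avoiding them into one of finitely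
many leaves. A leaf assigns each atom a cost (a hexadecimal digit, where `f` exceeds every bound and
so forbids the atom) and bounds the total cost. If `k + 2` is not a length either, only the vertex
leaves survive. There a weight that is at least 4 on every atom totals at most `4 * k + 3`, so `k`
is the maximum. Hence consecutive lengths differ by at most 2 (`add_one_or_add_two_mem`).

Additive weights on the group turn a cost bound on one factorization into a statement about the
sequence, hence about all of its factorizations. For a genuine gap above `k` this gives three
possibilities (`gap_cases`): all lengths have the same parity; or the gap lies just below the
maximum and the sequence lacks full support; or the gap lies just above the minimum, the minimum and
maximum have different parities, and the sequence has full support. Full support depends on the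
sequence alone, so the last two kinds of gap never occur together. This leaves four shapes
(`lengthSet_cases`). The numerical restrictions on intervals come from `two_mul_le_five_mul`,
`eq_one_of_one_mem` and `three_notMem`.

Conversely, adding copies of `0` shifts a set of lengths, so only sets with extremal minimum need be
realized. They come from multiples of `U + (-U)` with `U` an atom of length five, from multiples of
`4g + 4(-g)`, and from a few small summands. The list of shapes again does most of the work: a few
lengths and a missing one identify the whole set. -/

/-! ### Atoms, exchanges and leaves -/

/-- The minimal zero-sum sequences of length at least two, with the element `(a, b)` written
as `4 * a + b`. -/
def atomTerms : List (List ℕ) :=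
  [[6, 6], [5, 7], [4, 4], [2, 2], [1, 3], [3, 6, 7], [3, 4, 5], [2, 7, 7], [2, 5, 5], [2, 4, 6],
   [2, 3, 3], [1, 5, 6], [1, 4, 7], [1, 1, 2], [7, 7, 7, 7], [5, 5, 5, 5], [4, 6, 7, 7],
   [4, 5, 5, 6], [3, 3, 7, 7], [3, 3, 5, 5], [3, 3, 4, 6], [3, 3, 3, 3], [2, 3, 5, 6],
   [2, 3, 4, 7], [1, 2, 6, 7], [1, 2, 4, 5], [1, 1, 7, 7], [1, 1, 5, 5], [1, 1, 4, 6],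
   [1, 1, 1, 1], [3, 5, 5, 5, 6], [3, 4, 7, 7, 7], [3, 3, 3, 5, 6], [3, 3, 3, 4, 7],
   [1, 6, 7, 7, 7], [1, 4, 5, 5, 5], [1, 1, 1, 6, 7], [1, 1, 1, 4, 5]]

/-- Pairs of atoms whose sum is also a sum of three atoms. -/
def pairGains : List (List ℕ × List ℕ) :=
  [([5, 11], [0, 1, 4]), ([5, 17], [0, 1, 6]), ([5, 22], [0, 1, 10]), ([5, 24], [0, 4, 7]),
   ([5, 25], [1, 4, 9]), ([5, 27], [1, 4, 11]), ([5, 28], [0, 4, 12]), ([5, 30], [0, 1, 19]),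
   ([5, 32], [0, 1, 21]), ([5, 34], [0, 4, 14]), ([5, 35], [1, 4, 17]), ([5, 36], [0, 4, 26]),
   ([5, 37], [1, 4, 28]), ([6, 12], [1, 2, 4]), ([6, 16], [1, 2, 5]), ([6, 23], [1, 2, 10]),
   ([6, 24], [1, 4, 9]), ([6, 25], [2, 4, 8]), ([6, 26], [1, 4, 12]), ([6, 28], [2, 4, 11]),
   ([6, 31], [1, 2, 18]), ([6, 33], [1, 2, 21]), ([6, 34], [1, 4, 16]), ([6, 35], [2, 4, 15]),
   ([6, 36], [1, 4, 28]), ([6, 37], [2, 4, 27]), ([7, 8], [1, 1, 3]), ([7, 15], [1, 1, 8]),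
   ([7, 17], [1, 1, 9]), ([7, 19], [1, 1, 10]), ([7, 22], [1, 3, 5]), ([7, 25], [1, 3, 12]),
   ([7, 27], [1, 1, 13]), ([7, 30], [1, 1, 22]), ([7, 32], [1, 5, 10]), ([7, 35], [1, 1, 25]),
   ([7, 37], [1, 12, 13]), ([8, 14], [1, 1, 7]), ([8, 16], [1, 1, 9]), ([8, 18], [1, 1, 10]),
   ([8, 23], [1, 3, 6]), ([8, 24], [1, 3, 11]), ([8, 26], [1, 1, 13]), ([8, 31], [1, 1, 23]),
   ([8, 33], [1, 6, 10]), ([8, 34], [1, 1, 24]), ([8, 36], [1, 11, 13]), ([9, 9], [0, 2, 3]),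
   ([9, 16], [0, 2, 7]), ([9, 17], [0, 2, 8]), ([9, 20], [0, 2, 10]), ([9, 22], [0, 3, 6]),
   ([9, 23], [2, 3, 5]), ([9, 24], [0, 3, 12]), ([9, 25], [2, 3, 11]), ([9, 28], [0, 2, 13]),
   ([9, 30], [0, 6, 8]), ([9, 31], [2, 5, 7]), ([9, 32], [0, 6, 10]), ([9, 33], [2, 5, 10]),
   ([9, 34], [0, 7, 12]), ([9, 35], [2, 8, 11]), ([9, 36], [0, 12, 13]), ([9, 37], [2, 11, 13]),
   ([10, 13], [3, 4, 4]), ([10, 24], [3, 4, 5]), ([10, 25], [3, 4, 6]), ([10, 26], [4, 4, 7]),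
   ([10, 27], [4, 4, 8]), ([10, 28], [4, 4, 9]), ([10, 29], [4, 4, 13]), ([10, 34], [4, 5, 7]),
   ([10, 35], [4, 6, 8]), ([10, 36], [4, 4, 24]), ([10, 37], [4, 4, 25]), ([11, 16], [0, 1, 12]),
   ([11, 18], [1, 4, 5]), ([11, 20], [0, 4, 6]), ([11, 22], [0, 4, 8]), ([11, 23], [1, 4, 9]),
   ([11, 24], [0, 1, 13]), ([11, 30], [0, 4, 15]), ([11, 31], [1, 4, 16]),
   ([11, 32], [0, 4, 19]), ([11, 33], [1, 4, 20]), ([11, 34], [0, 1, 26]),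
   ([11, 36], [0, 1, 29]), ([12, 17], [1, 2, 11]), ([12, 19], [1, 4, 6]), ([12, 20], [2, 4, 5]),
   ([12, 22], [1, 4, 9]), ([12, 23], [2, 4, 7]), ([12, 25], [1, 2, 13]), ([12, 30], [1, 4, 17]),
   ([12, 31], [2, 4, 14]), ([12, 32], [1, 4, 20]), ([12, 33], [2, 4, 18]),
   ([12, 35], [1, 2, 27]), ([12, 37], [1, 2, 29]), ([13, 18], [4, 4, 7]), ([13, 19], [4, 4, 8]),
   ([13, 20], [4, 4, 9]), ([13, 21], [4, 4, 10]), ([13, 22], [3, 4, 11]), ([13, 23], [3, 4, 12]),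
   ([13, 30], [4, 8, 11]), ([13, 31], [4, 7, 12]), ([13, 32], [4, 4, 22]),
   ([13, 33], [4, 4, 23]), ([14, 17], [1, 1, 16]), ([14, 19], [1, 1, 18]), ([14, 22], [1, 5, 7]),
   ([14, 25], [1, 7, 12]), ([14, 27], [1, 1, 26]), ([14, 32], [1, 5, 18]),
   ([14, 37], [1, 12, 26]), ([15, 16], [1, 1, 17]), ([15, 18], [1, 1, 19]),
   ([15, 23], [1, 6, 8]), ([15, 24], [1, 8, 11]), ([15, 26], [1, 1, 27]), ([15, 33], [1, 6, 19]),
   ([15, 36], [1, 11, 27]), ([16, 16], [0, 2, 14]), ([16, 19], [1, 1, 20]),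
   ([16, 20], [0, 2, 18]), ([16, 22], [0, 1, 23]), ([16, 23], [2, 5, 7]), ([16, 24], [0, 7, 12]),
   ([16, 25], [1, 2, 24]), ([16, 27], [1, 1, 28]), ([16, 28], [0, 2, 26]),
   ([16, 30], [1, 5, 17]), ([16, 31], [2, 5, 14]), ([16, 32], [0, 1, 33]),
   ([16, 33], [2, 5, 18]), ([16, 34], [0, 12, 14]), ([16, 35], [1, 12, 17]),
   ([16, 36], [0, 12, 26]), ([16, 37], [1, 2, 36]), ([17, 17], [0, 2, 15]),
   ([17, 18], [1, 1, 20]), ([17, 20], [0, 2, 19]), ([17, 22], [0, 6, 8]), ([17, 23], [1, 2, 22]),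
   ([17, 24], [0, 1, 25]), ([17, 25], [2, 8, 11]), ([17, 26], [1, 1, 28]),
   ([17, 28], [0, 2, 27]), ([17, 30], [0, 6, 15]), ([17, 31], [1, 6, 16]),
   ([17, 32], [0, 6, 19]), ([17, 33], [1, 2, 32]), ([17, 34], [1, 11, 16]),
   ([17, 35], [2, 11, 15]), ([17, 36], [0, 1, 37]), ([17, 37], [2, 11, 27]),
   ([18, 19], [1, 1, 21]), ([18, 22], [1, 5, 10]), ([18, 24], [4, 5, 7]), ([18, 25], [1, 4, 23]),
   ([18, 26], [4, 4, 14]), ([18, 28], [4, 4, 16]), ([18, 29], [4, 4, 26]),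
   ([18, 30], [1, 1, 32]), ([18, 32], [1, 5, 21]), ([18, 34], [4, 5, 14]),
   ([18, 35], [1, 12, 19]), ([18, 36], [4, 4, 34]), ([18, 37], [4, 6, 26]),
   ([19, 23], [1, 6, 10]), ([19, 24], [1, 4, 22]), ([19, 25], [4, 6, 8]), ([19, 27], [4, 4, 15]),
   ([19, 28], [4, 4, 17]), ([19, 29], [4, 4, 27]), ([19, 31], [1, 1, 33]),
   ([19, 33], [1, 6, 21]), ([19, 34], [1, 11, 18]), ([19, 35], [4, 6, 15]),
   ([19, 36], [4, 5, 27]), ([19, 37], [4, 4, 35]), ([20, 20], [0, 2, 21]),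
   ([20, 22], [0, 6, 10]), ([20, 23], [2, 5, 10]), ([20, 24], [0, 4, 23]),
   ([20, 25], [2, 4, 22]), ([20, 26], [4, 4, 16]), ([20, 27], [4, 4, 17]),
   ([20, 29], [4, 4, 28]), ([20, 30], [0, 6, 19]), ([20, 31], [2, 5, 18]),
   ([20, 32], [0, 6, 21]), ([20, 33], [2, 5, 21]), ([20, 34], [0, 4, 31]),
   ([20, 35], [2, 4, 30]), ([20, 36], [4, 5, 28]), ([20, 37], [4, 6, 28]),
   ([21, 24], [4, 5, 10]), ([21, 25], [4, 6, 10]), ([21, 26], [4, 4, 18]),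
   ([21, 27], [4, 4, 19]), ([21, 28], [4, 4, 20]), ([21, 34], [4, 5, 18]),
   ([21, 35], [4, 6, 19]), ([22, 22], [0, 3, 19]), ([22, 23], [1, 3, 20]),
   ([22, 24], [3, 5, 11]), ([22, 25], [3, 4, 17]), ([22, 26], [1, 4, 24]),
   ([22, 27], [4, 8, 11]), ([22, 28], [0, 4, 25]), ([22, 29], [4, 11, 13]),
   ([22, 30], [0, 8, 19]), ([22, 31], [1, 5, 23]), ([22, 32], [0, 8, 21]),
   ([22, 33], [1, 9, 21]), ([22, 34], [1, 5, 24]), ([22, 35], [4, 8, 17]),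
   ([22, 36], [4, 11, 24]), ([22, 37], [4, 8, 28]), ([23, 23], [2, 3, 18]),
   ([23, 24], [3, 4, 16]), ([23, 25], [3, 6, 12]), ([23, 26], [4, 7, 12]),
   ([23, 27], [1, 4, 25]), ([23, 28], [2, 4, 24]), ([23, 29], [4, 12, 13]),
   ([23, 30], [1, 6, 22]), ([23, 31], [2, 7, 18]), ([23, 32], [1, 9, 21]),
   ([23, 33], [2, 7, 21]), ([23, 34], [4, 7, 16]), ([23, 35], [1, 6, 25]),
   ([23, 36], [4, 7, 28]), ([23, 37], [4, 12, 25]), ([24, 24], [0, 3, 26]),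
   ([24, 25], [1, 3, 28]), ([24, 27], [1, 11, 13]), ([24, 28], [0, 12, 13]),
   ([24, 30], [1, 11, 22]), ([24, 31], [4, 7, 16]), ([24, 32], [4, 5, 22]),
   ([24, 33], [4, 5, 23]), ([24, 34], [0, 7, 26]), ([24, 35], [1, 8, 28]),
   ([24, 36], [0, 7, 29]), ([24, 37], [1, 9, 29]), ([25, 25], [2, 3, 27]),
   ([25, 26], [1, 12, 13]), ([25, 28], [2, 11, 13]), ([25, 30], [4, 8, 17]),
   ([25, 31], [1, 12, 23]), ([25, 32], [4, 6, 22]), ([25, 33], [4, 6, 23]),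
   ([25, 34], [1, 7, 28]), ([25, 35], [2, 8, 27]), ([25, 36], [1, 9, 29]),
   ([25, 37], [2, 8, 29]), ([26, 27], [1, 1, 29]), ([26, 30], [1, 5, 27]),
   ([26, 31], [4, 12, 14]), ([26, 32], [4, 11, 18]), ([26, 33], [4, 4, 31]),
   ([26, 35], [1, 1, 37]), ([26, 37], [1, 12, 29]), ([27, 30], [4, 11, 15]),
   ([27, 31], [1, 6, 26]), ([27, 32], [4, 4, 30]), ([27, 33], [4, 12, 19]),
   ([27, 34], [1, 1, 36]), ([27, 36], [1, 11, 29]), ([28, 28], [0, 2, 29]),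
   ([28, 30], [0, 4, 35]), ([28, 31], [2, 4, 34]), ([28, 32], [4, 11, 20]),
   ([28, 33], [4, 12, 20]), ([28, 34], [0, 12, 26]), ([28, 35], [2, 11, 27]),
   ([28, 36], [0, 12, 29]), ([28, 37], [2, 11, 29]), ([29, 30], [4, 11, 27]),
   ([29, 31], [4, 12, 26]), ([30, 30], [0, 15, 19]), ([30, 31], [1, 16, 19]),
   ([30, 32], [0, 15, 21]), ([30, 33], [1, 6, 32]), ([30, 35], [4, 15, 17]),
   ([30, 36], [5, 11, 27]), ([30, 37], [4, 11, 35]), ([31, 31], [2, 14, 18]),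
   ([31, 32], [1, 5, 33]), ([31, 33], [2, 14, 21]), ([31, 34], [4, 14, 16]),
   ([31, 36], [4, 12, 34]), ([31, 37], [6, 12, 26]), ([32, 32], [0, 19, 21]),
   ([32, 33], [1, 20, 21]), ([32, 34], [5, 11, 18]), ([32, 35], [4, 6, 30]),
   ([32, 37], [4, 19, 28]), ([33, 33], [2, 18, 21]), ([33, 34], [4, 5, 31]),
   ([33, 35], [6, 12, 19]), ([33, 36], [4, 18, 28]), ([34, 34], [0, 14, 26]),
   ([34, 35], [1, 16, 27]), ([34, 36], [0, 14, 29]), ([34, 37], [1, 12, 36]),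
   ([35, 35], [2, 15, 27]), ([35, 36], [1, 11, 37]), ([35, 37], [2, 15, 29]),
   ([36, 36], [0, 26, 29]), ([36, 37], [1, 28, 29]), ([37, 37], [2, 27, 29])]

/-- Pairs of atoms whose sum is also a sum of four atoms, but not of three. -/
def pairDoubleGains : List (List ℕ × List ℕ) :=
  [([14, 15], [1, 1, 1, 1]), ([14, 30], [1, 1, 1, 5]), ([14, 35], [1, 1, 1, 12]),
   ([15, 31], [1, 1, 1, 6]), ([15, 34], [1, 1, 1, 11]), ([16, 17], [0, 1, 1, 2]),
   ([18, 27], [1, 1, 4, 4]), ([19, 26], [1, 1, 4, 4]), ([20, 28], [0, 2, 4, 4]),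
   ([21, 29], [4, 4, 4, 4]), ([21, 36], [4, 4, 4, 5]), ([21, 37], [4, 4, 4, 6]),
   ([29, 32], [4, 4, 4, 11]), ([29, 33], [4, 4, 4, 12]), ([30, 34], [1, 1, 5, 11]),
   ([31, 35], [1, 1, 6, 12]), ([32, 36], [4, 4, 5, 11]), ([33, 37], [4, 4, 6, 12])]

/-- Families of at least three atoms whose sum is also a sum of one more atom. The first entry is the
bit mask of the family. -/
def largeGains : List (ℕ × List ℕ × List ℕ) :=
  [(34359754753, [0, 14, 35], [1, 1, 11, 16]), (2147516417, [0, 15, 31], [1, 1, 5, 17]),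
   (134479873, [0, 18, 27], [1, 4, 5, 11]), (67633153, [0, 19, 26], [1, 4, 5, 11]),
   (137441050625, [0, 21, 37], [4, 4, 11, 20]), (9126805505, [0, 29, 33], [4, 4, 5, 28]),
   (36507222017, [0, 31, 35], [1, 4, 16, 17]), (146028888065, [0, 33, 37], [1, 4, 20, 28]),
   (269484034, [1, 20, 28], [0, 4, 6, 12]), (68721573890, [1, 21, 36], [4, 4, 11, 18]),
   (137441050626, [1, 21, 37], [4, 4, 12, 19]), (4831838210, [1, 29, 32], [4, 4, 5, 27]),
   (9126805506, [1, 29, 33], [4, 4, 6, 26]), (18253611010, [1, 30, 34], [0, 4, 14, 15]),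
   (36507222018, [1, 31, 35], [2, 4, 14, 15]), (73014444034, [1, 32, 36], [0, 4, 18, 27]),
   (146028888066, [1, 33, 37], [2, 4, 18, 27]), (1073758212, [2, 14, 30], [1, 1, 6, 16]),
   (17179901956, [2, 15, 34], [1, 1, 12, 17]), (134479876, [2, 18, 27], [1, 4, 6, 12]),
   (67633156, [2, 19, 26], [1, 4, 6, 12]), (68721573892, [2, 21, 36], [4, 4, 12, 20]),
   (4831838212, [2, 29, 32], [4, 4, 6, 28]), (18253611012, [2, 30, 34], [1, 4, 16, 17]),
   (73014444036, [2, 32, 36], [1, 4, 20, 28]), (49160, [3, 14, 15], [1, 1, 7, 8]),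
   (1073758216, [3, 14, 30], [1, 1, 7, 22]), (34359754760, [3, 14, 35], [1, 1, 7, 25]),
   (2147516424, [3, 15, 31], [1, 1, 8, 23]), (17179901960, [3, 15, 34], [1, 1, 8, 24]),
   (196616, [3, 16, 17], [0, 2, 7, 8]), (134479880, [3, 18, 27], [1, 1, 10, 13]),
   (67633160, [3, 19, 26], [1, 1, 10, 13]), (269484040, [3, 20, 28], [0, 2, 10, 13]),
   (538968072, [3, 21, 29], [4, 4, 10, 13]), (68721573896, [3, 21, 36], [4, 4, 10, 24]),
   (137441050632, [3, 21, 37], [4, 4, 10, 25]), (4831838216, [3, 29, 32], [4, 4, 13, 22]),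
   (9126805512, [3, 29, 33], [4, 4, 13, 23]), (18253611016, [3, 30, 34], [1, 1, 22, 24]),
   (36507222024, [3, 31, 35], [1, 1, 23, 25]), (73014444040, [3, 32, 36], [4, 4, 22, 24]),
   (146028888072, [3, 33, 37], [4, 4, 23, 25]), (1073758224, [4, 14, 30], [1, 1, 11, 18]),
   (34359754768, [4, 14, 35], [1, 1, 6, 26]), (2147516432, [4, 15, 31], [1, 1, 12, 19]),
   (17179901968, [4, 15, 34], [1, 1, 5, 27]), (196624, [4, 16, 17], [0, 1, 6, 12]),
   (18253611024, [4, 30, 34], [0, 1, 18, 27]), (36507222032, [4, 31, 35], [1, 2, 18, 27]),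
   (73014444048, [4, 32, 36], [0, 1, 21, 29]), (146028888080, [4, 33, 37], [1, 2, 21, 29]),
   (288, [5, 5, 8], [0, 1, 1, 10]), (8224, [5, 5, 13], [0, 4, 4, 7]),
   (32800, [5, 5, 15], [0, 1, 1, 19]), (524320, [5, 5, 19], [0, 1, 1, 21]),
   (67108896, [5, 5, 26], [0, 4, 4, 14]), (536870944, [5, 5, 29], [0, 4, 4, 26]),
   (608, [5, 6, 9], [0, 1, 2, 10]), (8288, [5, 6, 13], [1, 4, 4, 9]),
   (1048672, [5, 6, 20], [0, 1, 2, 21]), (536871008, [5, 6, 29], [1, 4, 4, 28]),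
   (800, [5, 8, 9], [0, 1, 3, 6]), (4384, [5, 8, 12], [1, 1, 4, 9]),
   (8480, [5, 8, 13], [1, 3, 4, 11]), (1048864, [5, 8, 20], [0, 1, 6, 10]),
   (536871200, [5, 8, 29], [1, 4, 11, 13]), (4640, [5, 9, 12], [0, 2, 4, 7]),
   (8736, [5, 9, 13], [0, 3, 4, 12]), (33312, [5, 9, 15], [0, 1, 6, 8]),
   (524832, [5, 9, 19], [0, 1, 6, 10]), (67109408, [5, 9, 26], [0, 4, 7, 12]),
   (536871456, [5, 9, 29], [0, 4, 12, 13]), (36896, [5, 12, 15], [1, 1, 4, 17]),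
   (69664, [5, 12, 16], [0, 2, 4, 14]), (40992, [5, 13, 15], [1, 4, 8, 11]),
   (73760, [5, 13, 16], [0, 4, 7, 12]), (1081376, [5, 15, 20], [0, 1, 6, 19]),
   (536903712, [5, 15, 29], [1, 4, 11, 27]), (2147516448, [5, 15, 31], [1, 1, 16, 19]),
   (67174432, [5, 16, 26], [0, 4, 12, 14]), (536936480, [5, 16, 29], [0, 4, 12, 26]),
   (1572896, [5, 19, 20], [0, 1, 6, 21]), (67633184, [5, 19, 26], [1, 4, 11, 18]),
   (9126805536, [5, 29, 33], [4, 4, 18, 28]), (192, [6, 6, 7], [1, 1, 2, 10]),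
   (8256, [6, 6, 13], [2, 4, 4, 8]), (16448, [6, 6, 14], [1, 1, 2, 18]),
   (262208, [6, 6, 18], [1, 1, 2, 21]), (134217792, [6, 6, 27], [2, 4, 4, 15]),
   (536870976, [6, 6, 29], [2, 4, 4, 27]), (704, [6, 7, 9], [1, 2, 3, 5]),
   (2240, [6, 7, 11], [1, 1, 4, 9]), (8384, [6, 7, 13], [1, 3, 4, 12]),
   (1048768, [6, 7, 20], [1, 2, 5, 10]), (536871104, [6, 7, 29], [1, 4, 12, 13]),
   (2624, [6, 9, 11], [0, 2, 4, 8]), (8768, [6, 9, 13], [2, 3, 4, 11]),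
   (16960, [6, 9, 14], [1, 2, 5, 7]), (262720, [6, 9, 18], [1, 2, 5, 10]),
   (134218304, [6, 9, 27], [2, 4, 8, 11]), (536871488, [6, 9, 29], [2, 4, 11, 13]),
   (18496, [6, 11, 14], [1, 1, 4, 16]), (133184, [6, 11, 17], [0, 2, 4, 15]),
   (24640, [6, 13, 14], [1, 4, 7, 12]), (139328, [6, 13, 17], [2, 4, 8, 11]),
   (1065024, [6, 14, 20], [1, 2, 5, 18]), (536887360, [6, 14, 29], [1, 4, 12, 26]),
   (1073758272, [6, 14, 30], [1, 1, 16, 19]), (134348864, [6, 17, 27], [2, 4, 11, 15]),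
   (537002048, [6, 17, 29], [2, 4, 11, 27]), (1310784, [6, 18, 20], [1, 2, 5, 21]),
   (134479936, [6, 18, 27], [1, 4, 12, 19]), (4831838272, [6, 29, 32], [4, 4, 19, 28]),
   (2688, [7, 9, 11], [0, 1, 3, 12]), (3200, [7, 10, 11], [1, 3, 4, 5]),
   (2176, [7, 11, 11], [0, 1, 1, 13]), (2099328, [7, 11, 21], [1, 4, 5, 10]),
   (268437632, [7, 11, 28], [0, 1, 12, 13]), (269484160, [7, 20, 28], [0, 2, 10, 26]),
   (538968192, [7, 21, 29], [4, 4, 10, 26]), (68721574016, [7, 21, 36], [4, 4, 10, 34]),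
   (9126805632, [7, 29, 33], [4, 4, 13, 31]), (4864, [8, 9, 12], [1, 2, 3, 11]),
   (5376, [8, 10, 12], [1, 3, 4, 6]), (4352, [8, 12, 12], [1, 1, 2, 13]),
   (2101504, [8, 12, 21], [1, 4, 6, 10]), (268439808, [8, 12, 28], [1, 2, 11, 13]),
   (269484288, [8, 20, 28], [0, 2, 10, 27]), (538968320, [8, 21, 29], [4, 4, 10, 27]),
   (137441050880, [8, 21, 37], [4, 4, 10, 35]), (4831838464, [8, 29, 32], [4, 4, 13, 30]),
   (3584, [9, 10, 11], [0, 3, 4, 6]), (5632, [9, 10, 12], [2, 3, 4, 5]),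
   (6656, [9, 11, 12], [0, 1, 2, 13]), (18944, [9, 11, 14], [0, 1, 7, 12]),
   (526848, [9, 11, 19], [0, 4, 6, 8]), (2099712, [9, 11, 21], [0, 4, 6, 10]),
   (67111424, [9, 11, 26], [0, 1, 12, 13]), (37376, [9, 12, 15], [1, 2, 8, 11]),
   (266752, [9, 12, 18], [2, 4, 5, 7]), (2101760, [9, 12, 21], [2, 4, 5, 10]),
   (134222336, [9, 12, 27], [1, 2, 11, 13]), (49664, [9, 14, 15], [1, 1, 7, 17]),
   (134480384, [9, 18, 27], [1, 1, 10, 28]), (67633664, [9, 19, 26], [1, 1, 10, 28]),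
   (538968576, [9, 21, 29], [4, 4, 10, 28]), (3072, [10, 11, 11], [0, 4, 4, 8]),
   (7168, [10, 11, 12], [1, 4, 4, 9]), (19456, [10, 11, 14], [1, 4, 5, 7]),
   (134144, [10, 11, 17], [0, 4, 6, 8]), (5120, [10, 12, 12], [2, 4, 4, 7]),
   (37888, [10, 12, 15], [1, 4, 6, 8]), (70656, [10, 12, 16], [2, 4, 5, 7]),
   (50176, [10, 14, 15], [1, 1, 7, 19]), (1073759232, [10, 14, 30], [1, 1, 7, 32]),
   (2147517440, [10, 15, 31], [1, 1, 8, 33]), (197632, [10, 16, 17], [0, 1, 6, 23]),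
   (18432, [11, 11, 14], [0, 1, 1, 26]), (526336, [11, 11, 19], [0, 4, 4, 15]),
   (2099200, [11, 11, 21], [0, 4, 4, 19]), (67110912, [11, 11, 26], [0, 1, 1, 29]),
   (2103296, [11, 12, 21], [1, 4, 4, 20]), (268441600, [11, 12, 28], [0, 1, 2, 29]),
   (2115584, [11, 14, 21], [1, 4, 5, 18]), (268453888, [11, 14, 28], [0, 1, 12, 26]),
   (34359756800, [11, 14, 35], [1, 1, 16, 27]), (657408, [11, 17, 19], [0, 4, 6, 15]),
   (2230272, [11, 17, 21], [0, 4, 6, 19]), (67635200, [11, 19, 26], [1, 4, 5, 27]),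
   (137441052672, [11, 21, 37], [4, 4, 19, 28]), (335546368, [11, 26, 28], [0, 1, 12, 29]),
   (36864, [12, 12, 15], [1, 1, 2, 27]), (266240, [12, 12, 18], [2, 4, 4, 14]),
   (2101248, [12, 12, 21], [2, 4, 4, 18]), (134221824, [12, 12, 27], [1, 1, 2, 29]),
   (2134016, [12, 15, 21], [1, 4, 6, 19]), (268472320, [12, 15, 28], [1, 2, 11, 27]),
   (17179906048, [12, 15, 34], [1, 1, 16, 27]), (331776, [12, 16, 18], [2, 4, 5, 14]),
   (2166784, [12, 16, 21], [2, 4, 5, 18]), (134483968, [12, 18, 27], [1, 4, 6, 26]),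
   (68721577984, [12, 21, 36], [4, 4, 18, 28]), (402657280, [12, 27, 28], [1, 2, 11, 29]),
   (57344, [13, 14, 15], [1, 1, 7, 27]), (34359762944, [13, 14, 35], [1, 1, 7, 37]),
   (17179910144, [13, 15, 34], [1, 1, 8, 36]), (204800, [13, 16, 17], [0, 1, 12, 25]),
   (1097728, [14, 15, 20], [1, 1, 16, 19]), (2146304, [14, 15, 21], [1, 1, 18, 19]),
   (268484608, [14, 15, 28], [1, 1, 16, 27]), (536920064, [14, 15, 29], [1, 1, 26, 27]),
   (269500416, [14, 20, 28], [0, 2, 18, 26]), (538984448, [14, 21, 29], [4, 4, 18, 26]),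
   (1075855360, [14, 21, 30], [1, 1, 18, 32]), (68721590272, [14, 21, 36], [4, 4, 18, 34]),
   (9126821888, [14, 29, 33], [4, 4, 26, 31]), (34896625664, [14, 29, 35], [1, 1, 26, 37]),
   (269516800, [15, 20, 28], [0, 2, 19, 27]), (539000832, [15, 21, 29], [4, 4, 19, 27]),
   (2149613568, [15, 21, 31], [1, 1, 19, 33]), (137441083392, [15, 21, 37], [4, 4, 19, 35]),
   (4831870976, [15, 29, 32], [4, 4, 27, 30]), (17716772864, [15, 29, 34], [1, 1, 27, 36]),
   (2293760, [16, 17, 21], [0, 1, 6, 33]), (537067520, [16, 17, 29], [0, 1, 12, 37]),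
   (539033600, [16, 21, 29], [4, 4, 18, 28]), (539099136, [17, 21, 29], [4, 4, 19, 28]),
   (134479872, [18, 18, 27], [1, 1, 21, 26]), (134479872, [18, 27, 27], [1, 1, 19, 29]),
   (67633152, [19, 19, 26], [1, 1, 21, 27]), (67633152, [19, 26, 26], [1, 1, 18, 29]),
   (538968067, [0, 1, 21, 29], [4, 4, 4, 5, 11]), (49169, [0, 4, 14, 15], [1, 1, 1, 5, 11]),
   (49217, [0, 6, 14, 15], [1, 1, 1, 5, 17]), (538968129, [0, 6, 21, 29], [4, 4, 4, 11, 20]),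
   (53249, [0, 12, 14, 15], [1, 1, 1, 11, 16]), (538972161, [0, 12, 21, 29], [4, 4, 4, 5, 28]),
   (538968070, [1, 2, 21, 29], [4, 4, 4, 6, 12]), (538968098, [1, 5, 21, 29], [4, 4, 4, 11, 18]),
   (538968130, [1, 6, 21, 29], [4, 4, 4, 12, 19]),
   (538970114, [1, 11, 21, 29], [4, 4, 4, 5, 27]),
   (538972162, [1, 12, 21, 29], [4, 4, 4, 6, 26]), (49172, [2, 4, 14, 15], [1, 1, 1, 6, 12]),
   (49188, [2, 5, 14, 15], [1, 1, 1, 6, 16]), (538968100, [2, 5, 21, 29], [4, 4, 4, 12, 20]),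
   (51204, [2, 11, 14, 15], [1, 1, 1, 12, 17]), (538970116, [2, 11, 21, 29], [4, 4, 4, 6, 28]),
   (49200, [4, 5, 14, 15], [1, 1, 1, 11, 18]), (49232, [4, 6, 14, 15], [1, 1, 1, 12, 19]),
   (51216, [4, 11, 14, 15], [1, 1, 1, 5, 27]), (53264, [4, 12, 14, 15], [1, 1, 1, 6, 26]),
   (96, [5, 5, 6, 6], [0, 1, 1, 2, 21]), (4128, [5, 5, 12, 12], [0, 2, 4, 4, 14]),
   (49248, [5, 6, 14, 15], [1, 1, 1, 16, 19]), (538972192, [5, 12, 21, 29], [4, 4, 4, 18, 28]),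
   (2112, [6, 6, 11, 11], [0, 2, 4, 4, 15]), (538970176, [6, 11, 21, 29], [4, 4, 4, 19, 28]),
   (6144, [11, 11, 12, 12], [0, 1, 1, 2, 29]), (55296, [11, 12, 14, 15], [1, 1, 1, 16, 27]),
   (49157, [0, 2, 14, 14, 15], [1, 1, 1, 1, 16, 16]),
   (49157, [0, 2, 14, 15, 15], [1, 1, 1, 1, 17, 17]),
   (538968069, [0, 2, 21, 21, 29], [4, 4, 4, 4, 20, 20]),
   (538968069, [0, 2, 21, 29, 29], [4, 4, 4, 4, 28, 28]),
   (538968066, [1, 1, 21, 21, 29], [4, 4, 4, 4, 18, 19]),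
   (538968066, [1, 1, 21, 29, 29], [4, 4, 4, 4, 26, 27]),
   (49168, [4, 4, 14, 14, 15], [1, 1, 1, 1, 18, 26]),
   (49168, [4, 4, 14, 15, 15], [1, 1, 1, 1, 19, 27])]

/-- For each atom the bit mask of its partners in `pairGains`. -/
def gainMasks : List ℕ :=
  [0, 0, 0, 0, 0, 263524059136, 268829790208, 177340055808, 96729383040, 274136760832,
   258755010560, 102036209696, 187952660544, 16122643456, 141906542848, 77402013824,
   274271406912, 274204086944, 263994386688, 269434056832, 274606537216, 52059709440,
   274875251360, 274875530048, 274273898336, 274206775008, 188088747328, 102105695392,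
   274138596960, 3235644416, 257695365792, 240515758912, 205618903712, 136899705664,
   273200123744, 272059274976, 269976833888, 265614743264]

/-- For each atom the bit mask of its partners in `pairGains` or `pairDoubleGains`. -/
def doubleGainMasks : List ℕ :=
  [0, 0, 0, 0, 0, 263524059136, 268829790208, 177340055808, 96729383040, 274136760832,
   258755010560, 102036209696, 187952660544, 16122643456, 177340055808, 96729383040,
   274271537984, 274204152480, 264128604416, 269501165696, 274874972672, 258755010560,
   274875251360, 274875530048, 274273898336, 274206775008, 188089271616, 102105957536,
   274139645536, 16122643456, 274875251360, 274875530048, 274875251360, 274875530048,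
   274273898336, 274206775008, 274273898336, 274206775008]

/-- For each of the four weights in `vertexWeights` the excess over `4` of the weights of the atoms,
as hexadecimal digits, with the bound `3`. -/
def vertexLeaves : List (List (ℕ × ℕ)) :=
  [[(0xa8a42428868464240240628042402402000000, 3)],
   [(0x42828a4a024042468684628000242404200000, 3)],
   [(0x8a4a4282864846420204260844202040200000, 3)],
   [(0x2428a8a4020424648648260802042042400000, 3)]]

/-- For each frame `(g, h)`: only `0`, `2(g + h)`, `g + (-g)`, `4g`, `4(-g)` are used, and at most one of
`(-h) + (g + h) + (-g)` and `(-h) + (g + h) + 3g`. -/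
def singleLeaves : List (ℕ × ℕ × List (ℕ × ℕ)) :=
  [(1, 5, [(0xf1ffffff0fffffff0fffffffffffffff10fff0, 1)]),
   (1, 7, [(0x1fffffff0fffffff0ffffffffffffff1f0f0ff, 1)]),
   (3, 5, [(0xffff1fff0fffffff0ffffffff1fffffff0f0ff, 1)]),
   (3, 7, [(0xfffff1ff0fffffff0fffffffff1ffffff0fff0, 1)]),
   (5, 1, [(0xfffffff1ffffffffffffff00ffffffff1fff00, 1)]),
   (5, 3, [(0xff1fffffffffffffffffff00f1fffffffff00f, 1)]),
   (7, 1, [(0xffffff1fffffffffffffff00fffffff1fff00f, 1)]),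
   (7, 3, [(0xfff1ffffffffffffffffff00ff1fffffffff00, 1)])]

/-- For each frame `(g, h)`: only `0`, `g + (-g)`, `4g`, `4(-g)` and at most once `h + (-h)` are used. -/
def inverseLeaves : List (ℕ × ℕ × List (ℕ × ℕ)) :=
  [(1, 5, [(0xffffffff0fffffff0ffffffffffffffff0ff1f, 1)]),
   (5, 1, [(0xffffffffffffffffffffff00fffffffff1ff0f, 1)])]

/-- For a support: only atoms of length at most two and at most two atoms of length four are used. -/
def balancedLeaves : List (List ℕ × List (ℕ × ℕ)) :=
  [([6, 4, 1, 3], [(0xffffffff11ffffff11fffffffffffffff0f0f0, 2)]),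
   ([6, 4, 5, 7], [(0xffffffffffffffffffff1111fffffffffff000, 2)]),
   ([1, 3, 5, 7], [(0xffffffff1f11ffff1f11ff11fffffffff0ff0f, 2)])]

/-- For each frame `(g, h)`: only `0`, `2(g + h)`, `4g`, `4(-g)` and at most once each of
`(-h) + (g + h) + 3g` and `h + (g + h) + 3(-g)` are used. -/
def twinLeaves : List (ℕ × ℕ × List (ℕ × ℕ)) :=
  [(1, 5, [(0xf1fff0ff0fffffff0ffffffffffffffffffff0, 1),
      (0xf0fff1ff0fffffff0ffffffffffffffffffff0, 1)]),
   (1, 7, [(0x1fff0fff0fffffff0ffffffffffffffffff0ff, 1),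
      (0xfff1fff0fffffff0ffffffffffffffffff0ff, 1)]),
   (5, 1, [(0xfff0fff1ffffffffffffff00fffffffffffff0, 1),
      (0xfff1fff0ffffffffffffff00fffffffffffff0, 1)]),
   (5, 3, [(0xff1fff0fffffffffffffff00fffffffffff0ff, 1),
      (0xff0fff1fffffffffffffff00fffffffffff0ff, 1)])]

/-! ### The exhaustive search and its soundness -/

/-- The `i`-th hexadecimal digit of `c` if `i < 38`, and `0` otherwise. -/
def digit (c i : ℕ) : ℕ := bif Nat.blt i 38 then (c >>> (4 * i)) % 16 else 0

/-- The sum of the digits of `c` at the entries of `T`. -/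
def listCost (c : ℕ) (T : List ℕ) : ℕ := T.foldr (fun i s => digit c i + s) 0

/-- Whether `S` is contained in `T`, counted with multiplicity. -/
def isSubfamily (S T : List ℕ) : Bool := S.all fun j => Nat.ble (S.count j) (T.count j)

/-- Run `test` on all `i < n` that have a nonzero digit in `c` and are not excluded by the bit mask `F`,
downwards, where every `i` is excluded after it has been tested. -/
def branchAll (c : ℕ) (test : ℕ → ℕ → Bool) : ℕ → ℕ → Bool
  | 0, _ => true
  | i + 1, F =>
    bif Nat.beq (digit c i) 0 || F.testBit i then branchAll c test i F
    else test i F && branchAll c test i (F ||| 1 <<< i)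

/-- A search for families of atoms that contain `T`, contain none of the families in `largeGains`, contain no
atom excluded by `F` outside `T`, and violate a bound in each of the given leaves. The result is `true` if
there are none. The bit mask of `T` is `m`. -/
def searchTree (masks : List ℕ) : ℕ → List ℕ → ℕ → ℕ → List (List (ℕ × ℕ)) → Bool
  | 0, _, _, _, _ => false
  | _ + 1, _, _, _, [] => false
  | fuel + 1, T, m, F, leaf :: leaves =>
    bif leaf.any (fun c => Nat.blt c.2 (listCost c.1 T)) then searchTree masks fuel T m F leaves
    else leaf.all fun c => branchAll c.1 (fun i F' =>
        largeGains.any (fun r =>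
          Nat.beq (r.1 &&& (m ||| 1 <<< i)) r.1 && isSubfamily r.2.1 (i :: T)) ||
        searchTree masks fuel (i :: T) (m ||| 1 <<< i) (F' ||| masks.getD i 0)
          (leaf :: leaves)) 38 F

/-- The leaves that describe the factorizations of length `k` for which `k + 1` is not a length. -/
def allLeaves : List (List (ℕ × ℕ)) :=
  vertexLeaves ++ (singleLeaves.map (·.2.2) ++ (balancedLeaves.map (·.2) ++
    (inverseLeaves.map (·.2.2) ++ twinLeaves.map (·.2.2))))

/-- When exchanges of two atoms for four are excluded too, the vertex leaves alone suffice. The fuel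
only has to exceed the depth of the search, since running out of it would give `false`. -/
theorem searchTree_doubleGainMasks :
    searchTree doubleGainMasks 30 [] 0 0 vertexLeaves = true := by
  decide +kernel

theorem searchTree_gainMasks : searchTree gainMasks 30 [] 0 0 allLeaves = true := by
  decide +kernel

/-- The cost of a family of atoms. -/
def cost (c : ℕ) (Z : Multiset ℕ) : ℕ := (Z.map (digit c)).sum

theorem cost_coe (c : ℕ) (T : List ℕ) : cost c (T : Multiset ℕ) = listCost c T := by
  induction T with
  | nil => rfl
  | cons i T ih =>
    rw [← Multiset.cons_coe]
    simp only [cost, Multiset.map_cons, Multiset.sum_cons] at ih ⊢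
    rw [ih]
    rfl

theorem digit_of_le {c i : ℕ} (hi : 38 ≤ i) : digit c i = 0 := by
  have : Nat.blt i 38 = false := by
    rw [Bool.eq_false_iff, Ne, Nat.blt_eq]
    omega
  simp [digit, this]

theorem isSubfamily_le {S T : List ℕ} (h : isSubfamily S T = true) :
    (S : Multiset ℕ) ≤ (T : Multiset ℕ) := by
  rw [Multiset.le_iff_count]
  intro j
  simp only [Multiset.coe_count]
  by_cases hj : j ∈ S
  · simp only [isSubfamily, List.all_eq_true] at h
    exact Nat.le_of_ble_eq_true (h j hj)
  · simp [List.count_eq_zero.2 hj]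

/-- The witness is the largest relevant index that occurs in `Y`. The larger ones tested before it
do not occur in `Y`, so excluding them loses nothing. -/
theorem exists_of_branchAll {c : ℕ} {test : ℕ → ℕ → Bool} {Y : Multiset ℕ} {n F : ℕ}
    (h : branchAll c test n F = true) (hF : ∀ i ∈ Y, F.testBit i = false)
    (hY : ∃ i ∈ Y, i < n ∧ digit c i ≠ 0) :
    ∃ i ∈ Y, ∃ F', (∀ j ∈ Y, F'.testBit j = false) ∧ test i F' = true := by
  induction n generalizing F with
  | zero => simp at hY
  | succ n ih =>
    have hlt : n ∉ Y ∨ digit c n = 0 → ∃ i ∈ Y, i < n ∧ digit c i ≠ 0 := by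
      rintro hn
      obtain ⟨i, hi, hin, hd⟩ := hY
      refine ⟨i, hi, lt_of_le_of_ne (Nat.lt_succ_iff.1 hin) ?_, hd⟩
      rintro rfl
      exact hn.elim (fun h => h hi) hd
    rw [branchAll] at h
    cases hc : Nat.beq (digit c n) 0 || F.testBit n with
    | true =>
      rw [hc, cond_true] at h
      refine ih h hF (hlt ?_)
      rcases Bool.or_eq_true_iff.1 hc with h0 | h0
      · exact Or.inr (Nat.eq_of_beq_eq_true h0)
      · refine Or.inl fun hn => ?_
        rw [hF n hn] at h0
        exact Bool.false_ne_true h0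
    | false =>
      rw [hc, cond_false, Bool.and_eq_true] at h
      by_cases hn : n ∈ Y
      · exact ⟨n, hn, F, hF, h.1⟩
      · refine ih h.2 (fun i hi => ?_) (hlt (Or.inl hn))
        have hne : n ≠ i := by
          rintro rfl
          exact hn hi
        simp [Nat.testBit_or, hF i hi, Nat.one_shiftLeft, hne]

/-- If the search succeeds, then a family without the given subfamilies satisfies all bounds of a leaf. -/
theorem exists_leaf_of_searchTree {masks : List ℕ} {Z : Multiset ℕ}
    (hmask : ∀ i j, (masks.getD i 0).testBit j = true → ¬ ({i, j} : Multiset ℕ) ≤ Z)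
    (hlarge : ∀ r ∈ largeGains, ¬ (r.2.1 : Multiset ℕ) ≤ Z) {fuel : ℕ} {T : List ℕ} {m F : ℕ}
    {leaves : List (List (ℕ × ℕ))} (h : searchTree masks fuel T m F leaves = true)
    (hT : (T : Multiset ℕ) ≤ Z) (hF : ∀ i ∈ Z - (T : Multiset ℕ), F.testBit i = false) :
    ∃ leaf ∈ leaves, ∀ c ∈ leaf, cost c.1 Z ≤ c.2 := by
  induction fuel generalizing T m F leaves with
  | zero => simp [searchTree] at h
  | succ fuel ih =>
    cases leaves with
    | nil => simp [searchTree] at h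
    | cons leaf leaves =>
      rw [searchTree] at h
      cases hany : leaf.any (fun c => Nat.blt c.2 (listCost c.1 T)) with
      | true =>
        rw [hany, cond_true] at h
        obtain ⟨l, hl, hc⟩ := ih h hT hF
        exact ⟨l, List.mem_cons_of_mem _ hl, hc⟩
      | false =>
        rw [hany, cond_false] at h
        by_cases hleaf : ∀ c ∈ leaf, cost c.1 Z ≤ c.2
        · exact ⟨leaf, List.mem_cons_self, hleaf⟩
        push Not at hleaf
        obtain ⟨c, hc, hlt⟩ := hleaf
        have hTc : cost c.1 (T : Multiset ℕ) ≤ c.2 := by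
          rw [List.any_eq_false] at hany
          have := hany c hc
          rw [Nat.blt_eq] at this
          rw [cost_coe]
          omega
        have hsplit : cost c.1 Z = cost c.1 (Z - (T : Multiset ℕ)) + cost c.1 (T : Multiset ℕ) := by
          conv_lhs => rw [← tsub_add_cancel_of_le hT]
          simp [cost]
        -- `T` respects the bound that `Z` violates, so some atom of `Z` outside `T` has positive
        -- cost; the search branches over such atoms.
        have hex : ∃ i ∈ Z - (T : Multiset ℕ), i < 38 ∧ digit c.1 i ≠ 0 := by
          by_contra! hno
          have h0 : cost c.1 (Z - (T : Multiset ℕ)) = 0 := by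
            refine Multiset.sum_eq_zero fun x hx => ?_
            obtain ⟨i, hi, rfl⟩ := Multiset.mem_map.1 hx
            rcases lt_or_ge i 38 with h38 | h38
            · exact hno i hi h38
            · exact digit_of_le h38
          omega
        obtain ⟨i, hi, F', hF', htest⟩ := exists_of_branchAll (List.all_eq_true.1 h c hc) hF hex
        have hiT : ((i :: T : List ℕ) : Multiset ℕ) ≤ Z := by
          rw [← Multiset.cons_coe, ← Multiset.singleton_add, add_comm]
          exact (le_tsub_iff_left hT).1 (Multiset.singleton_le.2 hi)
        have hsub : Z - ((i :: T : List ℕ) : Multiset ℕ) ≤ Z - (T : Multiset ℕ) :=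
          tsub_le_tsub_left (by
            rw [← Multiset.cons_coe]
            exact Multiset.le_cons_self _ _) _
        rcases Bool.or_eq_true_iff.1 htest with h1 | h1
        · rw [List.any_eq_true] at h1
          obtain ⟨r, hr, hr'⟩ := h1
          exact absurd ((isSubfamily_le (Bool.and_eq_true_iff.1 hr').2).trans hiT) (hlarge r hr)
        -- The newly excluded atoms are the partners of `i`, and `Z` contains none of these in
        -- addition to `i`.
        · refine ih h1 hiT fun j hj => ?_
          rw [Nat.testBit_or, hF' j (Multiset.mem_of_le hsub hj), Bool.false_or, Bool.eq_false_iff]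
          intro hbit
          refine hmask i j hbit (le_trans ?_ ((le_tsub_iff_left hiT).1 (Multiset.singleton_le.2 hj)))
          rw [← Multiset.cons_coe]
          change i ::ₘ {j} ≤ _
          rw [Multiset.cons_add]
          exact Multiset.cons_le_cons _ (Multiset.le_add_left _ _)

/-! ### The group and the classification of its atoms -/

/-- The element of `C₂ ⊕ C₄` with number `n`. -/
def el (n : ℕ) : ZMod 2 × ZMod 4 := (((n / 4 : ℕ) : ZMod 2), (n : ZMod 4))

/-- The number of an element of `C₂ ⊕ C₄`. -/
def idx (x : ZMod 2 × ZMod 4) : ℕ := 4 * x.1.val + x.2.val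

theorem el_idx (x : ZMod 2 × ZMod 4) : el (idx x) = x := by
  revert x
  decide

theorem idx_lt (x : ZMod 2 × ZMod 4) : idx x < 8 := by
  revert x
  decide

theorem idx_el {n : ℕ} (hn : n < 8) : idx (el n) = n := by
  revert n
  decide

/-- The terms of the atom with number `i`; all numbers from `38` on stand for the sequence `0`. -/
def atomList (i : ℕ) : List ℕ := atomTerms.getD i [0]

/-- The atom with number `i`. -/
def atom (i : ℕ) : Multiset (ZMod 2 × ZMod 4) := ((atomList i).map el : List (ZMod 2 × ZMod 4))

theorem atomList_of_le {i : ℕ} (hi : 38 ≤ i) : atomList i = atomList 38 := by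
  have h : atomTerms.length ≤ i := hi
  rw [atomList, List.getD_eq_default _ _ h]
  rfl

/-- A property of all atoms need only be checked for finitely many numbers. -/
theorem forall_atomList {p : List ℕ → Prop} (h : ∀ i < 39, p (atomList i)) (i : ℕ) :
    p (atomList i) := by
  rcases lt_or_ge i 38 with hi | hi
  · exact h i (by omega)
  · rw [atomList_of_le hi]
    exact h 38 (by omega)

theorem lt_of_mem_atomList {i n : ℕ} (hn : n ∈ atomList i) : n < 8 :=
  forall_atomList (p := fun l => ∀ n ∈ l, n < 8) (by decide +kernel) i n hn

theorem map_idx_atom (i : ℕ) : (atom i).map idx = (atomList i : Multiset ℕ) := by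
  rw [atom, Multiset.map_coe, List.map_map]
  congr 1
  exact (List.map_congr_left fun n hn => idx_el (lt_of_mem_atomList hn)).trans (List.map_id _)

theorem map_el_map_idx (A : Multiset (ZMod 2 × ZMod 4)) : (A.map idx).map el = A := by
  rw [Multiset.map_map]
  exact (Multiset.map_congr rfl fun x _ => el_idx x).trans (Multiset.map_id _)

theorem atom_le_of_coe_le {i : ℕ} {A : Multiset (ZMod 2 × ZMod 4)}
    (h : (atomList i : Multiset ℕ) ≤ A.map idx) : atom i ≤ A := by
  have := Multiset.map_le_map (f := el) h
  rwa [map_el_map_idx, Multiset.map_coe] at this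

theorem atom_ne_zero (i : ℕ) : atom i ≠ 0 := by
  have h : atomList i ≠ [] := forall_atomList (p := fun l => l ≠ []) (by decide +kernel) i
  simpa [atom] using h

theorem sum_map_el (l : List ℕ) :
    (l.map el).sum = ((((l.map (· / 4)).sum : ℕ) : ZMod 2), ((l.sum : ℕ) : ZMod 4)) := by
  induction l with
  | nil => rfl
  | cons n l ih => simp [ih, el]

theorem sum_atom (i : ℕ) : (atom i).sum = 0 := by
  have h : (l : List ℕ) → l = atomList i → (l.map (· / 4)).sum % 2 = 0 ∧ l.sum % 4 = 0 := by
    rintro l rfl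
    exact forall_atomList (p := fun l => (l.map (· / 4)).sum % 2 = 0 ∧ l.sum % 4 = 0)
      (by decide +kernel) i
  obtain ⟨h1, h2⟩ := h _ rfl
  rw [atom, Multiset.sum_coe, sum_map_el, Prod.mk_eq_zero]
  exact ⟨(ZMod.natCast_eq_zero_iff _ _).2 (Nat.dvd_of_mod_eq_zero h1),
    (ZMod.natCast_eq_zero_iff _ _).2 (Nat.dvd_of_mod_eq_zero h2)⟩

/-- Whether the sequence with the given multiplicities is empty, has nonzero sum or contains an atom. -/
def containsAtom (a b c d e f g : ℕ) : Bool :=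
  let v := [0, a, b, c, d, e, f, g]
  Nat.beq (a + b + c + d + e + f + g) 0 || (!Nat.beq ((d + e + f + g) % 2) 0 ||
    (!Nat.beq ((a + 2 * b + 3 * c + e + 2 * f + 3 * g) % 4) 0 ||
      atomTerms.any fun l => l.all fun n => Nat.ble (l.count n) (v.getD n 0)))

/-- A sequence with larger multiplicities contains a power of a single element that is an atom, so
these 2048 cases are all that is needed. -/
theorem containsAtom_of_lt {a b c d e f g : ℕ} (ha : a < 4) (hb : b < 2) (hc : c < 4) (hd : d < 2)
    (he : e < 4) (hf : f < 2) (hg : g < 4) : containsAtom a b c d e f g = true := by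
  have h : (List.range 4).all (fun a => (List.range 2).all fun b => (List.range 4).all fun c =>
      (List.range 2).all fun d => (List.range 4).all fun e => (List.range 2).all fun f =>
      (List.range 4).all fun g => containsAtom a b c d e f g) = true := by
    decide +kernel
  simp only [List.all_eq_true, List.mem_range] at h
  exact h a ha b hb c hc d hd e he f hf g hg

theorem exists_atomList_eq {l : List ℕ} (hl : l ∈ atomTerms) : ∃ i, atomList i = l := by
  obtain ⟨i, hi, rfl⟩ := List.mem_iff_getElem.1 hl
  exact ⟨i, by simp [atomList, hi]⟩

theorem sum_map_idx {M : Type*} [AddCommMonoid M] (A : Multiset (ZMod 2 × ZMod 4)) (f : ℕ → M) :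
    ((A.map idx).map f).sum = ∑ n ∈ Finset.range 8, (A.map idx).count n • f n := by
  rw [Finset.sum_multiset_map_count]
  refine Finset.sum_subset (fun n hn => ?_) fun n _ hn => ?_
  · obtain ⟨x, -, rfl⟩ := Multiset.mem_map.1 (Multiset.mem_toFinset.1 hn)
    exact Finset.mem_range.2 (idx_lt x)
  · rw [Multiset.count_eq_zero.2 fun h => hn (Multiset.mem_toFinset.2 h), zero_smul]

/-- If no atom divides `A`, then the atoms `0`, `2g` for order two and `4g` for order four bound all
multiplicities, and the finite check applies. -/
theorem exists_atom_le {A : Multiset (ZMod 2 × ZMod 4)} (hA : A.sum = 0) (h0 : A ≠ 0) :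
    ∃ i, atom i ≤ A := by
  by_contra! hno
  obtain ⟨c, hc⟩ : ∃ c : ℕ → ℕ, ∀ n, (A.map idx).count n = c n := ⟨_, fun _ => rfl⟩
  have hlist : ∀ l ∈ [0] :: atomTerms, ¬ ∀ n ∈ l, l.count n ≤ c n := by
    intro l hl hall
    obtain ⟨i, rfl⟩ : ∃ i, atomList i = l := by
      rcases List.mem_cons.1 hl with rfl | hl
      · exact ⟨38, rfl⟩
      · exact exists_atomList_eq hl
    refine hno i (atom_le_of_coe_le (Multiset.le_iff_count.2 fun n => ?_))
    by_cases hn : n ∈ atomList i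
    · rw [Multiset.coe_count, hc]
      exact hall n hn
    · rw [Multiset.coe_count, List.count_eq_zero.2 hn]
      exact Nat.zero_le _
  have c0 : c 0 = 0 := by
    have := hlist [0] (by simp)
    simp at this
    omega
  have key : ∀ n k, List.replicate k n ∈ atomTerms → k ≠ 0 → c n < k := by
    intro n k hk h0
    have := hlist _ (List.mem_cons_of_mem _ hk)
    by_contra! hle
    refine this fun m hm => ?_
    obtain rfl := List.eq_of_mem_replicate hm
    simpa using hle
  have h1 := key 1 4 (by decide) (by decide)
  have h2 := key 2 2 (by decide) (by decide)
  have h3 := key 3 4 (by decide) (by decide)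
  have h4 := key 4 2 (by decide) (by decide)
  have h5 := key 5 4 (by decide) (by decide)
  have h6 := key 6 2 (by decide) (by decide)
  have h7 := key 7 4 (by decide) (by decide)
  have hcon := containsAtom_of_lt h1 h2 h3 h4 h5 h6 h7
  have hsum : ((A.map idx).map el).sum = 0 := by rw [map_el_map_idx, hA]
  have hcard : ((A.map idx).map fun _ => 1).sum ≠ 0 := by simpa using h0
  rw [sum_map_idx] at hsum hcard
  simp only [Finset.sum_range_succ, Finset.sum_range_zero, hc, c0] at hsum hcard
  obtain ⟨hs1, hs2⟩ := Prod.mk_eq_zero.1 (Prod.mk.eta.trans hsum)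
  simp only [el, Prod.fst_add, Prod.snd_add, Prod.smul_fst, Prod.smul_snd] at hs1 hs2
  simp only [nsmul_eq_mul] at hs1 hs2
  have e1 : ((c 4 + c 5 + c 6 + c 7 : ℕ) : ZMod 2) = 0 := by
    rw [← hs1]
    norm_num
  have e2 : ((c 1 + 2 * c 2 + 3 * c 3 + c 5 + 2 * c 6 + 3 * c 7 : ℕ) : ZMod 4) = 0 := by
    rw [← hs2]
    have e4 : (4 : ZMod 4) = 0 := rfl
    have e5 : (5 : ZMod 4) = 1 := rfl
    have e6 : (6 : ZMod 4) = 2 := rfl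
    have e7 : (7 : ZMod 4) = 3 := rfl
    push_cast
    rw [e4, e5, e6, e7]
    simp only [Prod.snd_zero]
    ring
  rw [ZMod.natCast_eq_zero_iff] at e1 e2
  simp only [containsAtom, Bool.or_eq_true, Bool.not_eq_true', List.any_eq_true,
    List.all_eq_true] at hcon
  rcases hcon with h | h | h | ⟨l, hl, h⟩
  · have := Nat.eq_of_beq_eq_true h
    simp at hcard
    omega
  · rw [Nat.mod_eq_zero_of_dvd e1] at h
    simp at h
  · rw [Nat.mod_eq_zero_of_dvd e2] at h
    simp at h
  · refine hlist l (List.mem_cons_of_mem _ hl) fun n hn => ?_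
    have h' := Nat.le_of_ble_eq_true (h n hn)
    obtain ⟨i, rfl⟩ := exists_atomList_eq hl
    have h8 := lt_of_mem_atomList hn
    interval_cases n
    all_goals simpa [c0] using h'

/-- A nonempty zero-sum part contains a listed atom, and no listed atom properly contains another
one. -/
theorem eq_of_le_atom {i : ℕ} {B : Multiset (ZMod 2 × ZMod 4)} (hB : B ≤ atom i) (hs : B.sum = 0)
    (h0 : B ≠ 0) : B = atom i := by
  obtain ⟨j, hj⟩ := exists_atom_le hs h0
  have hle : (atomList j : Multiset ℕ) ≤ (atomList i : Multiset ℕ) := by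
    rw [← map_idx_atom, ← map_idx_atom]
    exact Multiset.map_le_map (hj.trans hB)
  have hsub : isSubfamily (atomList j) (atomList i) = true := by
    simp only [isSubfamily, List.all_eq_true]
    intro n _
    refine Nat.ble_eq_true_of_le ?_
    have := Multiset.le_iff_count.1 hle n
    rwa [Multiset.coe_count, Multiset.coe_count] at this
  have key : ∀ i < 39, ∀ j < 39, isSubfamily (atomList j) (atomList i) = true →
      atomList j = atomList i := by
    decide +kernel
  have heq : atomList j = atomList i :=
    forall_atomList (p := fun l => isSubfamily (atomList j) l = true → atomList j = l)
      (fun i hi => forall_atomList (p := fun l => isSubfamily l (atomList i) = true → l = atomList i)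
        (key i hi) j) i hsub
  have hji : atom j = atom i := by rw [atom, atom, heq]
  exact le_antisymm hB (hji ▸ hj)

theorem isAddUnit_iff {u : zeroSumMonoid (ZMod 2 × ZMod 4)} : IsAddUnit u ↔ u.1 = 0 := by
  constructor
  · intro h
    obtain ⟨v, hv⟩ := isAddUnit_iff_exists_neg.1 h
    have : u.1 + v.1 = 0 := congrArg Subtype.val hv
    exact (add_eq_zero.1 this).1
  · intro h
    have : u = 0 := Subtype.ext h
    rw [this]
    exact isAddUnit_zero

theorem addIrreducible_iff_atom {u : zeroSumMonoid (ZMod 2 × ZMod 4)} :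
    AddIrreducible u ↔ ∃ i, u.1 = atom i := by
  constructor
  · intro hu
    obtain ⟨i, hi⟩ := exists_atom_le u.2 fun h => hu.not_isAddUnit (isAddUnit_iff.2 h)
    obtain ⟨B, hB⟩ := Multiset.le_iff_exists_add.1 hi
    have hBs : B.sum = 0 := by
      have : u.1.sum = 0 := u.2
      rwa [hB, Multiset.sum_add, sum_atom, zero_add] at this
    have hsplit : u = (⟨atom i, sum_atom i⟩ : zeroSumMonoid (ZMod 2 × ZMod 4)) + ⟨B, hBs⟩ :=
      Subtype.ext hB
    rcases hu.isAddUnit_or_isAddUnit hsplit with h | h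
    · exact absurd (isAddUnit_iff.1 h) (atom_ne_zero i)
    · have hB0 : B = 0 := isAddUnit_iff.1 h
      exact ⟨i, by rw [hB, hB0, add_zero]⟩
  · rintro ⟨i, hi⟩
    refine ⟨fun h => atom_ne_zero i (hi ▸ isAddUnit_iff.1 h), fun {a b} hab => ?_⟩
    have hsum : atom i = a.1 + b.1 := by
      rw [← hi, hab]
      rfl
    by_cases ha : a.1 = 0
    · exact Or.inl (isAddUnit_iff.2 ha)
    · have := eq_of_le_atom (hsum ▸ Multiset.le_add_right _ _) a.2 ha
      rw [← this, left_eq_add] at hsum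
      exact Or.inr (isAddUnit_iff.2 hsum)

/-! ### Sets of lengths and exchanges -/

/-- The set of lengths of a sequence, in terms of the numbering of the atoms. -/
def lengthSet (A : Multiset (ZMod 2 × ZMod 4)) : Set ℕ :=
  {k | ∃ Z : Multiset ℕ, (Z.map atom).sum = A ∧ Z.card = k}

theorem setOfLengths_eq (a : zeroSumMonoid (ZMod 2 × ZMod 4)) :
    setOfLengths a = lengthSet a.1 := by
  ext k
  constructor
  · rintro (⟨ha, rfl⟩ | ⟨-, s, hs, hsum, rfl⟩)
    · exact ⟨0, by simp [isAddUnit_iff.1 ha], rfl⟩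
    · choose! f hf using fun u (hu : u ∈ s) => addIrreducible_iff_atom.1 (hs u hu)
      refine ⟨s.map f, ?_, Multiset.card_map _ _⟩
      rw [← hsum, Multiset.map_map, ← AddSubmonoid.coe_subtype, map_multiset_sum]
      exact congrArg _ (Multiset.map_congr rfl fun u hu => (hf u hu).symm)
  · rintro ⟨Z, hZ, rfl⟩
    by_cases ha : IsAddUnit a
    · refine Or.inl ⟨ha, ?_⟩
      rw [isAddUnit_iff.1 ha] at hZ
      rw [Multiset.card_eq_zero, Multiset.eq_zero_iff_forall_notMem]
      intro i hi
      exact atom_ne_zero i (Multiset.sum_eq_zero_iff.1 hZ _ (Multiset.mem_map_of_mem _ hi))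
    · refine Or.inr ⟨ha, Z.map fun i => ⟨atom i, sum_atom i⟩, ?_, ?_, Multiset.card_map _ _⟩
      · intro u hu
        obtain ⟨i, -, rfl⟩ := Multiset.mem_map.1 hu
        exact addIrreducible_iff_atom.2 ⟨i, rfl⟩
      · refine Subtype.ext ?_
        rw [← hZ, ← AddSubmonoid.coe_subtype, map_multiset_sum, Multiset.map_map]
        rfl

theorem exists_mem_lengthSet {A : Multiset (ZMod 2 × ZMod 4)} (hA : A.sum = 0) :
    ∃ k, k ∈ lengthSet A := by
  induction h : A.card using Nat.strong_induction_on generalizing A with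
  | _ n ih =>
    subst h
    by_cases h0 : A = 0
    · exact ⟨0, 0, by simp [h0], rfl⟩
    obtain ⟨i, hi⟩ := exists_atom_le hA h0
    obtain ⟨B, rfl⟩ := Multiset.le_iff_exists_add.1 hi
    rw [Multiset.sum_add, sum_atom, zero_add] at hA
    have hpos := Multiset.card_pos.2 (atom_ne_zero i)
    obtain ⟨k, Z, hZ, -⟩ := ih B.card (by rw [Multiset.card_add]; omega) hA rfl
    exact ⟨_, i ::ₘ Z, by rw [Multiset.map_cons, Multiset.sum_cons, hZ], rfl⟩

theorem sum_map_atom_coe (l : List ℕ) :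
    ((l : Multiset ℕ).map atom).sum = (((l.flatMap atomList).map el : List _) : Multiset _) := by
  induction l with
  | nil => rfl
  | cons i l ih =>
    rw [← Multiset.cons_coe, Multiset.map_cons, Multiset.sum_cons, ih, List.flatMap_cons,
      List.map_append, ← Multiset.coe_add]
    rfl

/-- Whether two families of atoms have the same sum. -/
def sameSum (S T : List ℕ) : Bool := (S.flatMap atomList).isPerm (T.flatMap atomList)

theorem sum_eq_of_sameSum {S T : List ℕ} (h : sameSum S T = true) :
    ((S : Multiset ℕ).map atom).sum = ((T : Multiset ℕ).map atom).sum := by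
  rw [sum_map_atom_coe, sum_map_atom_coe, Multiset.coe_eq_coe]
  exact (List.isPerm_iff.1 h).map _

/-- Replacing `S` by `T` inside `Z` keeps the sum and changes the length by a known amount. -/
theorem card_exchange_mem {Z S T : Multiset ℕ} (hle : S ≤ Z)
    (hsum : (S.map atom).sum = (T.map atom).sum) :
    Z.card - S.card + T.card ∈ lengthSet (Z.map atom).sum := by
  obtain ⟨Y, rfl⟩ := Multiset.le_iff_exists_add.1 hle
  refine ⟨Y + T, ?_, ?_⟩
  · simp only [Multiset.map_add, Multiset.sum_add, hsum]
    exact add_comm _ _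
  · simp only [Multiset.card_add]
    omega

/-- This certifies the entries of the tables. Their completeness is never needed: a missing exchange
could only make the search fail. -/
theorem sameSum_gains :
    (pairGains.all fun r => sameSum r.1 r.2 && Nat.beq r.2.length (r.1.length + 1)) &&
    ((pairDoubleGains.all fun r => sameSum r.1 r.2 && Nat.beq r.2.length (r.1.length + 2)) &&
    largeGains.all fun r => sameSum r.2.1 r.2.2 && Nat.beq r.2.2.length (r.2.1.length + 1)) := by
  decide +kernel

/-- The bit mask of the partners of `i` in a list of pairs. -/
def partnerMask (R : List (List ℕ × List ℕ)) (i : ℕ) : ℕ :=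
  R.foldr (fun r m => match r.1 with
    | [a, b] => (bif Nat.beq a i then 1 <<< b else 0) ||| ((bif Nat.beq b i then 1 <<< a else 0) ||| m)
    | _ => m) 0

theorem exists_of_testBit_partnerMask {R : List (List ℕ × List ℕ)} {i j : ℕ}
    (h : (partnerMask R i).testBit j = true) :
    ∃ r ∈ R, (r.1 : Multiset ℕ) = {i, j} := by
  induction R with
  | nil => simp [partnerMask] at h
  | cons r R ih =>
    have hbit : ∀ x y : ℕ, (bif Nat.beq x i then 1 <<< y else 0).testBit j = true → x = i ∧ y = j := by
      intro x y hxy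
      cases hx : Nat.beq x i with
      | true =>
        rw [hx, cond_true, Nat.one_shiftLeft, Nat.testBit_two_pow] at hxy
        exact ⟨Nat.eq_of_beq_eq_true hx, of_decide_eq_true hxy⟩
      | false => simp [hx] at hxy
    obtain ⟨l, l'⟩ := r
    have hR : (partnerMask R i).testBit j = true → ∃ r ∈ (l, l') :: R, (r.1 : Multiset ℕ) = {i, j} := by
      intro h'
      obtain ⟨r, hr, hr'⟩ := ih h'
      exact ⟨r, List.mem_cons_of_mem _ hr, hr'⟩
    rw [partnerMask, List.foldr_cons, ← partnerMask] at h
    match l, h with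
    | [], h => exact hR h
    | [_], h => exact hR h
    | _ :: _ :: _ :: _, h => exact hR h
    | [a, b], h =>
      simp only [Nat.testBit_or, Bool.or_eq_true] at h
      rcases h with h | h | h
      · obtain ⟨rfl, rfl⟩ := hbit _ _ h
        exact ⟨_, List.mem_cons_self, rfl⟩
      · obtain ⟨rfl, rfl⟩ := hbit _ _ h
        exact ⟨_, List.mem_cons_self, Multiset.pair_comm _ _⟩
      · exact hR h

theorem gainMasks_eq : gainMasks = (List.range 38).map (partnerMask pairGains) := by
  decide +kernel

theorem doubleGainMasks_eq :
    doubleGainMasks = (List.range 38).map (partnerMask (pairGains ++ pairDoubleGains)) := by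
  decide +kernel

theorem exists_of_testBit_getD {R : List (List ℕ × List ℕ)} {i j : ℕ}
    (h : (((List.range 38).map (partnerMask R)).getD i 0).testBit j = true) :
    ∃ r ∈ R, (r.1 : Multiset ℕ) = {i, j} := by
  rcases lt_or_ge i 38 with hi | hi
  · rw [List.getD_eq_getElem _ _ (by simpa using hi), List.getElem_map, List.getElem_range] at h
    exact exists_of_testBit_partnerMask h
  · rw [List.getD_eq_default _ _ (by simpa using hi)] at h
    simp at h

theorem card_add_one_mem {Z : Multiset ℕ} {r : List ℕ × List ℕ} (hr : r ∈ pairGains)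
    (hle : (r.1 : Multiset ℕ) ≤ Z) : Z.card + 1 ∈ lengthSet (Z.map atom).sum := by
  have h := List.all_eq_true.1 (Bool.and_eq_true_iff.1 sameSum_gains).1 r hr
  obtain ⟨h1, h2⟩ := Bool.and_eq_true_iff.1 h
  have h3 := card_exchange_mem hle (sum_eq_of_sameSum h1)
  have h4 := Multiset.card_le_card hle
  rw [Multiset.coe_card, Multiset.coe_card, Nat.eq_of_beq_eq_true h2] at h3
  rw [Multiset.coe_card] at h4
  convert h3 using 1
  omega

theorem card_add_two_mem {Z : Multiset ℕ} {r : List ℕ × List ℕ} (hr : r ∈ pairDoubleGains)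
    (hle : (r.1 : Multiset ℕ) ≤ Z) : Z.card + 2 ∈ lengthSet (Z.map atom).sum := by
  have h := List.all_eq_true.1
    (Bool.and_eq_true_iff.1 (Bool.and_eq_true_iff.1 sameSum_gains).2).1 r hr
  obtain ⟨h1, h2⟩ := Bool.and_eq_true_iff.1 h
  have h3 := card_exchange_mem hle (sum_eq_of_sameSum h1)
  have h4 := Multiset.card_le_card hle
  rw [Multiset.coe_card, Multiset.coe_card, Nat.eq_of_beq_eq_true h2] at h3
  rw [Multiset.coe_card] at h4
  convert h3 using 1
  omega

theorem card_add_one_mem_of_largeGains {Z : Multiset ℕ} {r : ℕ × List ℕ × List ℕ}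
    (hr : r ∈ largeGains) (hle : (r.2.1 : Multiset ℕ) ≤ Z) :
    Z.card + 1 ∈ lengthSet (Z.map atom).sum := by
  have h := List.all_eq_true.1
    (Bool.and_eq_true_iff.1 (Bool.and_eq_true_iff.1 sameSum_gains).2).2 r hr
  obtain ⟨h1, h2⟩ := Bool.and_eq_true_iff.1 h
  have h3 := card_exchange_mem hle (sum_eq_of_sameSum h1)
  have h4 := Multiset.card_le_card hle
  rw [Multiset.coe_card, Multiset.coe_card, Nat.eq_of_beq_eq_true h2] at h3
  rw [Multiset.coe_card] at h4
  convert h3 using 1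
  omega

/-- A factorization of length `k`, where `k + 1` is not a length, satisfies a leaf. -/
theorem exists_leaf {Z : Multiset ℕ} (h : Z.card + 1 ∉ lengthSet (Z.map atom).sum) :
    ∃ leaf ∈ allLeaves, ∀ c ∈ leaf, cost c.1 Z ≤ c.2 := by
  refine exists_leaf_of_searchTree (fun i j hij hle => ?_)
    (fun r hr hle => h (card_add_one_mem_of_largeGains hr hle)) searchTree_gainMasks
    (Multiset.zero_le Z) (fun i _ => Nat.zero_testBit i)
  rw [gainMasks_eq] at hij
  obtain ⟨r, hr, hr'⟩ := exists_of_testBit_getD hij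
  exact h (card_add_one_mem hr (hr' ▸ hle))

/-- A factorization of length `k`, where `k + 1` and `k + 2` are not lengths, satisfies a vertex leaf. -/
theorem exists_vertexLeaf {Z : Multiset ℕ} (h : Z.card + 1 ∉ lengthSet (Z.map atom).sum)
    (h' : Z.card + 2 ∉ lengthSet (Z.map atom).sum) :
    ∃ leaf ∈ vertexLeaves, ∀ c ∈ leaf, cost c.1 Z ≤ c.2 := by
  refine exists_leaf_of_searchTree (fun i j hij hle => ?_)
    (fun r hr hle => h (card_add_one_mem_of_largeGains hr hle)) searchTree_doubleGainMasks
    (Multiset.zero_le Z) (fun i _ => Nat.zero_testBit i)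
  rw [doubleGainMasks_eq] at hij
  obtain ⟨r, hr, hr'⟩ := exists_of_testBit_getD hij
  rcases List.mem_append.1 hr with hr | hr
  · exact h (card_add_one_mem hr (hr' ▸ hle))
  · exact h' (card_add_two_mem hr (hr' ▸ hle))

/-! ### Weights -/

/-- The sum of the weights `t` over a list of numbers of elements. -/
def listWeight (t : ℕ → ℤ) (l : List ℕ) : ℤ := (l.map t).sum

/-- The weight of a sequence. -/
def weight (t : ℕ → ℤ) (A : Multiset (ZMod 2 × ZMod 4)) : ℤ := ((A.map idx).map t).sum

theorem weight_add (t : ℕ → ℤ) (A B : Multiset (ZMod 2 × ZMod 4)) :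
    weight t (A + B) = weight t A + weight t B := by
  simp [weight]

theorem weight_nsmul (t : ℕ → ℤ) (k : ℕ) (A : Multiset (ZMod 2 × ZMod 4)) :
    weight t (k • A) = k * weight t A := by
  rw [weight, Multiset.map_nsmul, Multiset.map_nsmul, Multiset.sum_nsmul, nsmul_eq_mul, weight]

theorem weight_atom (t : ℕ → ℤ) (i : ℕ) : weight t (atom i) = listWeight t (atomList i) := by
  rw [weight, map_idx_atom, Multiset.map_coe, Multiset.sum_coe, listWeight]

theorem weight_sum (t : ℕ → ℤ) (Z : Multiset ℕ) :
    weight t (Z.map atom).sum = (Z.map fun i => listWeight t (atomList i)).sum := by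
  induction Z using Multiset.induction with
  | empty => rfl
  | cons i Z ih => rw [Multiset.map_cons, Multiset.sum_cons, weight_add, ih, weight_atom,
      Multiset.map_cons, Multiset.sum_cons]

theorem weight_sum_le {t : ℕ → ℤ} {Z : Multiset ℕ} {f : ℕ → ℤ}
    (h : ∀ i ∈ Z, listWeight t (atomList i) ≤ f i) :
    weight t (Z.map atom).sum ≤ (Z.map f).sum := by
  rw [weight_sum]
  exact Multiset.sum_map_le_sum_map _ _ h

theorem weight_sum_le_mul {t : ℕ → ℤ} {Z : Multiset ℕ} {b : ℤ}
    (h : ∀ i ∈ Z, listWeight t (atomList i) ≤ b) : weight t (Z.map atom).sum ≤ Z.card * b := by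
  simpa using weight_sum_le (f := fun _ => b) h

theorem mul_le_weight_sum {t : ℕ → ℤ} {Z : Multiset ℕ} {b : ℤ}
    (h : ∀ i ∈ Z, b ≤ listWeight t (atomList i)) : Z.card * b ≤ weight t (Z.map atom).sum := by
  rw [weight_sum]
  simpa using Multiset.sum_map_le_sum_map (s := Z) (fun _ => b) _ h

/-- The link between leaves and sequences: where the costs dominate a weight on the atoms, a cost
bound for one factorization bounds a quantity shared by all factorizations of the same sequence. -/
theorem weight_sum_le_cost {t : ℕ → ℤ} {Z : Multiset ℕ} {a b : ℤ} {c : ℕ}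
    (h : ∀ i ∈ Z, listWeight t (atomList i) ≤ a + b * digit c i) :
    weight t (Z.map atom).sum ≤ Z.card * a + b * cost c Z := by
  refine (weight_sum_le h).trans_eq ?_
  rw [Multiset.sum_map_add, Multiset.sum_map_mul_left]
  simp [cost]

/-- A weight that is 4 modulo 8 on every atom in use reads off the parity of the length from the
sequence. -/
theorem weight_sum_mod_eight {t : ℕ → ℤ} {Z : Multiset ℕ}
    (h : ∀ i ∈ Z, listWeight t (atomList i) % 8 = 4) :
    (weight t (Z.map atom).sum - 4 * Z.card) % 8 = 0 := by
  rw [weight_sum]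
  induction Z using Multiset.induction with
  | empty => rfl
  | cons i Z ih =>
    have h1 := ih fun j hj => h j (Multiset.mem_cons_of_mem hj)
    have h2 := h i (Multiset.mem_cons_self _ _)
    rw [Multiset.map_cons, Multiset.sum_cons, Multiset.card_cons]
    push_cast
    omega

theorem weight_nonneg {t : ℕ → ℤ} (ht : ∀ n < 8, 0 ≤ t n) (A : Multiset (ZMod 2 × ZMod 4)) :
    0 ≤ weight t A := by
  refine Multiset.sum_nonneg fun x hx => ?_
  obtain ⟨n, hn, rfl⟩ := Multiset.mem_map.1 hx
  obtain ⟨y, -, rfl⟩ := Multiset.mem_map.1 hn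
  exact ht _ (idx_lt y)

theorem weight_mono {t : ℕ → ℤ} (ht : ∀ n < 8, 0 ≤ t n) {A B : Multiset (ZMod 2 × ZMod 4)}
    (h : A ≤ B) : weight t A ≤ weight t B := by
  obtain ⟨C, rfl⟩ := Multiset.le_iff_exists_add.1 h
  rw [weight_add]
  have := weight_nonneg ht C
  omega

theorem atom_le_sum {Z : Multiset ℕ} {i : ℕ} (hi : i ∈ Z) : atom i ≤ (Z.map atom).sum :=
  Multiset.single_le_sum (fun _ _ => Multiset.zero_le _) _ (Multiset.mem_map_of_mem _ hi)

theorem listWeight_le {t : ℕ → ℤ} (ht : ∀ n < 8, 0 ≤ t n) {Z : Multiset ℕ} {i : ℕ} (hi : i ∈ Z) :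
    listWeight t (atomList i) ≤ weight t (Z.map atom).sum := by
  rw [← weight_atom]
  exact weight_mono ht (atom_le_sum hi)

theorem le_weight_of_mem {t : ℕ → ℤ} (ht : ∀ n < 8, 0 ≤ t n) {A : Multiset (ZMod 2 × ZMod 4)}
    {n : ℕ} (hn : n ∈ A.map idx) : t n ≤ weight t A := by
  obtain ⟨x, hx, rfl⟩ := Multiset.mem_map.1 hn
  have := weight_mono ht (Multiset.singleton_le.2 hx)
  simpa [weight] using this

theorem digit_le_cost {c i : ℕ} {Z : Multiset ℕ} (hi : i ∈ Z) : digit c i ≤ cost c Z :=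
  Multiset.single_le_sum (fun _ _ => Nat.zero_le _) _ (Multiset.mem_map_of_mem _ hi)

/-- A property of all atoms and their costs need only be checked for finitely many numbers. -/
theorem forall_atomList_digit {c : ℕ} {p : List ℕ → ℕ → Prop}
    (h : ∀ i < 39, p (atomList i) (digit c i)) (i : ℕ) : p (atomList i) (digit c i) := by
  rcases lt_or_ge i 38 with hi | hi
  · exact h i (by omega)
  · rw [atomList_of_le hi, digit_of_le hi]
    exact h 38 (by omega)

/-- The weight with the given list of values. -/
def tableWeight (w : List ℤ) (n : ℕ) : ℤ := w.getD n 0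

/-- Weights whose least value on the atoms is `4`; they give the maximal length. -/
def vertexWeights : List (List ℤ) :=
  [[4, 3, 2, 1, 2, 3, 2, 1], [4, 1, 2, 3, 2, 3, 2, 1], [4, 3, 2, 1, 2, 1, 2, 3],
   [4, 1, 2, 3, 2, 1, 2, 3]]

theorem exists_vertexWeight : ∀ leaf ∈ vertexLeaves, ∃ c ∈ leaf, c.2 = 3 ∧ ∃ w ∈ vertexWeights,
    ∀ i < 39, listWeight (tableWeight w) (atomList i) = 4 + digit c.1 i := by
  decide +kernel

theorem four_mul_le_weight {w : List ℤ} (hw : w ∈ vertexWeights) {l : ℕ}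
    {A : Multiset (ZMod 2 × ZMod 4)} (hl : l ∈ lengthSet A) : 4 * (l : ℤ) ≤ weight (tableWeight w) A := by
  obtain ⟨Z, rfl, rfl⟩ := hl
  have h : ∀ w ∈ vertexWeights, ∀ i < 39, 4 ≤ listWeight (tableWeight w) (atomList i) := by
    decide +kernel
  have := mul_le_weight_sum (Z := Z) fun i _ =>
    forall_atomList (p := fun l => 4 ≤ listWeight (tableWeight w) l) (h w hw) i
  omega

/-- The total weight is at least `4 * l` for every length `l` and at most `4 * Z.card + 3`. -/
theorem le_card_of_vertexLeaf {Z : Multiset ℕ} {leaf : List (ℕ × ℕ)} (hleaf : leaf ∈ vertexLeaves)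
    (hc : ∀ c ∈ leaf, cost c.1 Z ≤ c.2) : ∀ l ∈ lengthSet (Z.map atom).sum, l ≤ Z.card := by
  intro l hl
  obtain ⟨c, hcl, hc3, w, hw, hwt⟩ := exists_vertexWeight leaf hleaf
  have hcost := hc c hcl
  have h1 := four_mul_le_weight hw hl
  have h2 := weight_sum_le_cost (t := tableWeight w) (Z := Z) (a := 4) (b := 1) (c := c.1)
    fun i _ => (forall_atomList_digit (p := fun l d => listWeight (tableWeight w) l ≤ 4 + 1 * d)
      (fun i hi => by rw [hwt i hi, one_mul]) i)
  omega

/-! ### Frames and leaves that force equal parity -/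

/-- The number of the negative of an element. -/
def negIdx (n : ℕ) : ℕ := 4 * (n / 4) + (4 - n % 4) % 4

/-- The number of the sum of two elements. -/
def addIdx (m n : ℕ) : ℕ := 4 * ((m / 4 + n / 4) % 2) + (m + n) % 4

/-- The weight with the given values at `0, g + h, g, -g, h, -h` and at all other elements. -/
def frameWeight (g h : ℕ) (w : List ℤ) (n : ℕ) : ℤ :=
  -- For every other element `idxOf` returns 6, which selects the seventh entry of `w`.
  w.getD ([0, addIdx g h, g, negIdx g, h, negIdx h].idxOf n) 0

/-- All factorizations have lengths of the same parity and within a factor of two. -/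
def HasParity (A : Multiset (ZMod 2 × ZMod 4)) : Prop :=
  ∀ k ∈ lengthSet A, ∀ l ∈ lengthSet A, k % 2 = l % 2 ∧ l ≤ 2 * k

/-- The weights in `cs` limit the terms of `A` and thereby the atoms available to any factorization.
On those atoms `p` determines the parity of the length, and `w` stays within a factor of two. -/
theorem hasParity_of_weights {A : Multiset (ZMod 2 × ZMod 4)} {cs : List (ℕ → ℤ)} {p w : ℕ → ℤ}
    (hpos : ∀ t ∈ cs, ∀ n < 8, 0 ≤ t n) (hA : ∀ t ∈ cs, weight t A ≤ 1)
    (h : ∀ i < 39, (∀ t ∈ cs, listWeight t (atomList i) ≤ 1) →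
      listWeight p (atomList i) % 8 = 4 ∧ 2 ≤ listWeight w (atomList i) ∧
        listWeight w (atomList i) ≤ 4) : HasParity A := by
  have key : ∀ k ∈ lengthSet A, (weight p A - 4 * k) % 8 = 0 ∧ 2 * (k : ℤ) ≤ weight w A ∧
      weight w A ≤ 4 * k := by
    rintro k ⟨Z, rfl, rfl⟩
    have hZ : ∀ i ∈ Z, listWeight p (atomList i) % 8 = 4 ∧ 2 ≤ listWeight w (atomList i) ∧
        listWeight w (atomList i) ≤ 4 := fun i hi =>
      forall_atomList (p := fun l => (∀ t ∈ cs, listWeight t l ≤ 1) →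
        listWeight p l % 8 = 4 ∧ 2 ≤ listWeight w l ∧ listWeight w l ≤ 4) h i
        fun t ht => (listWeight_le (hpos t ht) hi).trans (hA t ht)
    have h1 := mul_le_weight_sum fun i hi => (hZ i hi).2.1
    have h2 := weight_sum_le_mul fun i hi => (hZ i hi).2.2
    exact ⟨weight_sum_mod_eight fun i hi => (hZ i hi).1, by omega, by omega⟩
  intro k hk l hl
  have h1 := key k hk
  have h2 := key l hl
  omega

/-- The frames, that is, the pairs of elements of order four that generate the group. -/
def frames : List (ℕ × ℕ) := [(1, 5), (1, 7), (3, 5), (3, 7), (5, 1), (5, 3), (7, 1), (7, 3)]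

/-- A frame weight with nonnegative values is nonnegative. -/
theorem frameWeight_nonneg {g h : ℕ} {w : List ℤ} (hw : ∀ x ∈ w, 0 ≤ x) (n : ℕ) :
    0 ≤ frameWeight g h w n := by
  rw [frameWeight, List.getD_eq_getElem?_getD]
  cases hx : w[[0, addIdx g h, g, negIdx g, h, negIdx h].idxOf n]? with
  | none => simp
  | some x => simpa using hw x (List.mem_of_getElem? hx)

/-- The bounds allow only `0`, `g + h`, `±g` and at most one `-h`. On these elements `p` modulo 4 is
the homomorphism with `g, h ↦ 1`; its lift modulo 8 is chosen so that every remaining atom gets the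
value 4. -/
theorem hasParity_of_single : ∀ f ∈ frames, ∀ A,
    weight (frameWeight f.1 f.2 [0, 0, 0, 0, 0, 1, 2]) A ≤ 1 →
    weight (frameWeight f.1 f.2 [0, 0, 0, 0, 2, 0, 0]) A ≤ 1 → HasParity A := by
  intro f hf A h1 h2
  refine hasParity_of_weights
    (cs := [frameWeight f.1 f.2 [0, 0, 0, 0, 0, 1, 2], frameWeight f.1 f.2 [0, 0, 0, 0, 2, 0, 0]])
    (p := frameWeight f.1 f.2 [4, 2, 1, 3, 1, 7, 0])
    (w := frameWeight f.1 f.2 [2, 1, 1, 1, 0, 0, 0]) ?_ ?_ ?_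
  · simp only [List.forall_mem_cons, List.not_mem_nil, false_implies, implies_true, and_true]
    exact ⟨fun n _ => frameWeight_nonneg (by simp) n, fun n _ => frameWeight_nonneg (by simp) n⟩
  · simp [h1, h2]
  · clear h1 h2
    revert f
    simp only [List.forall_mem_cons, List.not_mem_nil, false_implies, implies_true, and_true]
    decide +kernel

/-- Here only `0`, `±g` and at most one each of `h` and `-h` occur. As `h` is not a multiple of `g`,
these two can be used only in the atom `h + (-h)`, so giving both the value 2 makes `p` equal to 4
modulo 8 on all available atoms. -/
theorem hasParity_of_inverse : ∀ f ∈ frames, ∀ A,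
    weight (frameWeight f.1 f.2 [0, 2, 0, 0, 1, 0, 2]) A ≤ 1 →
    weight (frameWeight f.1 f.2 [0, 2, 0, 0, 0, 1, 2]) A ≤ 1 → HasParity A := by
  intro f hf A h1 h2
  refine hasParity_of_weights
    (cs := [frameWeight f.1 f.2 [0, 2, 0, 0, 1, 0, 2], frameWeight f.1 f.2 [0, 2, 0, 0, 0, 1, 2]])
    (p := frameWeight f.1 f.2 [4, 0, 1, 3, 2, 2, 0])
    (w := frameWeight f.1 f.2 [2, 1, 1, 1, 1, 1, 1]) ?_ ?_ ?_
  · simp only [List.forall_mem_cons, List.not_mem_nil, false_implies, implies_true, and_true]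
    exact ⟨fun n _ => frameWeight_nonneg (by simp) n, fun n _ => frameWeight_nonneg (by simp) n⟩
  · simp [h1, h2]
  · clear h1 h2
    revert f
    simp only [List.forall_mem_cons, List.not_mem_nil, false_implies, implies_true, and_true]
    decide +kernel

/-- All elements of order four occur, and an element of order two that is not a multiple of them. -/
def HasFullSupport (A : Multiset (ZMod 2 × ZMod 4)) : Prop :=
  (∀ n ∈ [1, 3, 5, 7], n ∈ A.map idx) ∧ ∃ n ∈ [4, 6], n ∈ A.map idx

theorem hasParity_of_singleLeaf {Z : Multiset ℕ} {L : ℕ × ℕ × List (ℕ × ℕ)} (hL : L ∈ singleLeaves)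
    (hc : ∀ c ∈ L.2.2, cost c.1 Z ≤ c.2) : HasParity (Z.map atom).sum := by
  have hdata : ∀ L ∈ singleLeaves, (L.1, L.2.1) ∈ frames ∧ ∃ c ∈ L.2.2, c.2 = 1 ∧ ∀ i < 39,
      listWeight (frameWeight L.1 L.2.1 [0, 0, 0, 0, 0, 1, 2]) (atomList i) ≤ 0 + 1 * digit c.1 i ∧
      listWeight (frameWeight L.1 L.2.1 [0, 0, 0, 0, 2, 0, 0]) (atomList i) ≤ 0 + 1 * digit c.1 i := by
    decide +kernel
  obtain ⟨hf, c, hcL, hc1, h⟩ := hdata L hL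
  have hcost := hc c hcL
  have h1 := weight_sum_le_cost (Z := Z) fun i _ => (forall_atomList_digit
    (p := fun l d => listWeight (frameWeight L.1 L.2.1 [0, 0, 0, 0, 0, 1, 2]) l ≤ 0 + 1 * d)
    (fun i hi => (h i hi).1) i)
  have h2 := weight_sum_le_cost (Z := Z) fun i _ => (forall_atomList_digit
    (p := fun l d => listWeight (frameWeight L.1 L.2.1 [0, 0, 0, 0, 2, 0, 0]) l ≤ 0 + 1 * d)
    (fun i hi => (h i hi).2) i)
  exact hasParity_of_single _ hf _ (by dsimp only; omega) (by dsimp only; omega)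

theorem hasParity_of_inverseLeaf {Z : Multiset ℕ} {L : ℕ × ℕ × List (ℕ × ℕ)}
    (hL : L ∈ inverseLeaves) (hc : ∀ c ∈ L.2.2, cost c.1 Z ≤ c.2) : HasParity (Z.map atom).sum := by
  have hdata : ∀ L ∈ inverseLeaves, (L.1, L.2.1) ∈ frames ∧ ∃ c ∈ L.2.2, c.2 = 1 ∧ ∀ i < 39,
      listWeight (frameWeight L.1 L.2.1 [0, 2, 0, 0, 1, 0, 2]) (atomList i) ≤ 0 + 1 * digit c.1 i ∧
      listWeight (frameWeight L.1 L.2.1 [0, 2, 0, 0, 0, 1, 2]) (atomList i) ≤ 0 + 1 * digit c.1 i := by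
    decide +kernel
  obtain ⟨hf, c, hcL, hc1, h⟩ := hdata L hL
  have hcost := hc c hcL
  have h1 := weight_sum_le_cost (Z := Z) fun i _ => (forall_atomList_digit
    (p := fun l d => listWeight (frameWeight L.1 L.2.1 [0, 2, 0, 0, 1, 0, 2]) l ≤ 0 + 1 * d)
    (fun i hi => (h i hi).1) i)
  have h2 := weight_sum_le_cost (Z := Z) fun i _ => (forall_atomList_digit
    (p := fun l d => listWeight (frameWeight L.1 L.2.1 [0, 2, 0, 0, 0, 1, 2]) l ≤ 0 + 1 * d)
    (fun i hi => (h i hi).2) i)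
  exact hasParity_of_inverse _ hf _ (by dsimp only; omega) (by dsimp only; omega)

/-! ### Balanced leaves -/

/-- The weight that counts the nonzero elements outside of a list. -/
def outsideWeight (S : List ℕ) (n : ℕ) : ℤ := bif (0 :: S).contains n then 0 else 1

theorem outsideWeight_nonneg (S : List ℕ) (n : ℕ) : 0 ≤ outsideWeight S n := by
  unfold outsideWeight
  cases (0 :: S).contains n <;> simp

/-- The length, where a term `0` counts twice. -/
def halfWeight : ℕ → ℤ := tableWeight [2, 1, 1, 1, 1, 1, 1, 1]

theorem two_mul_le_halfWeight {A : Multiset (ZMod 2 × ZMod 4)} {l : ℕ} (hl : l ∈ lengthSet A) :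
    2 * (l : ℤ) ≤ weight halfWeight A := by
  obtain ⟨Z, rfl, rfl⟩ := hl
  have := mul_le_weight_sum (Z := Z) fun i _ =>
    forall_atomList (p := fun l => 2 ≤ listWeight halfWeight l) (by decide +kernel) i
  omega

/-- Five is the Davenport constant of the group. -/
theorem halfWeight_le_five_mul {A : Multiset (ZMod 2 × ZMod 4)} {l : ℕ} (hl : l ∈ lengthSet A) :
    weight halfWeight A ≤ 5 * (l : ℤ) := by
  obtain ⟨Z, rfl, rfl⟩ := hl
  have := weight_sum_le_mul (Z := Z) fun i _ =>
    forall_atomList (p := fun l => listWeight halfWeight l ≤ 5) (by decide +kernel) i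
  omega

/-- Each support misses an element of order four or both `4` and `6`. Its atoms have half weight
between 2 and 4, which gives the factor two; since at most two atoms of `Z` have length four, the
half weight is at most `2 * Z.card + 4`, so no length exceeds `Z.card + 2`. -/
theorem balanced_bounds {Z : Multiset ℕ} {L : List ℕ × List (ℕ × ℕ)} (hL : L ∈ balancedLeaves)
    (hc : ∀ c ∈ L.2, cost c.1 Z ≤ c.2) : ¬ HasFullSupport (Z.map atom).sum ∧
      ∀ l ∈ lengthSet (Z.map atom).sum, l ≤ Z.card + 2 ∧
        ∀ k ∈ lengthSet (Z.map atom).sum, l ≤ 2 * k := by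
  have hdata : ∀ L ∈ balancedLeaves, (∃ n ∈ [1, 3, 5, 7], outsideWeight L.1 n = 1) ∨
      (∀ n ∈ [4, 6], outsideWeight L.1 n = 1) := by
    decide +kernel
  have hcdata : ∀ L ∈ balancedLeaves, ∃ c ∈ L.2, c.2 = 2 ∧ ∀ i < 39,
      (digit c.1 i ≤ 2 → listWeight (outsideWeight L.1) (atomList i) ≤ 0) ∧
      (listWeight halfWeight (atomList i) ≤ 2 + 2 * digit c.1 i) := by
    decide +kernel
  have hfour : ∀ L ∈ balancedLeaves, ∀ i < 39, listWeight (outsideWeight L.1) (atomList i) ≤ 0 →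
      listWeight halfWeight (atomList i) ≤ 4 := by
    decide +kernel
  obtain ⟨c, hcL, hc2, h⟩ := hcdata L hL
  have hcost := hc c hcL
  have hout : weight (outsideWeight L.1) (Z.map atom).sum ≤ 0 := by
    have := weight_sum_le_mul (t := outsideWeight L.1) (Z := Z) (b := 0) fun i hi =>
      forall_atomList_digit (p := fun l d => d ≤ 2 → listWeight (outsideWeight L.1) l ≤ 0)
        (fun i hi => (h i hi).1) i ((digit_le_cost hi).trans (hcost.trans hc2.le))
    simpa using this
  refine ⟨fun hfull => ?_, fun l hl => ⟨?_, ?_⟩⟩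
  · rcases hdata L hL with ⟨n, hn, hn1⟩ | h46
    · have := le_weight_of_mem (fun n _ => outsideWeight_nonneg L.1 n) (hfull.1 n hn)
      omega
    · obtain ⟨n, hn, hn1⟩ := hfull.2
      have := le_weight_of_mem (fun n _ => outsideWeight_nonneg L.1 n) hn1
      have := h46 n hn
      omega
  · have h1 := two_mul_le_halfWeight hl
    have h2 := weight_sum_le_cost (t := halfWeight) (Z := Z) fun i _ => (forall_atomList_digit
      (p := fun l d => listWeight halfWeight l ≤ 2 + 2 * d) (fun i hi => (h i hi).2) i)
    omega
  · rintro k ⟨Y, hY, rfl⟩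
    have h1 := two_mul_le_halfWeight hl
    rw [← hY] at hout h1
    have h2 := weight_sum_le_mul (t := halfWeight) (Z := Y) fun i hi => (forall_atomList
      (p := fun l => listWeight (outsideWeight L.1) l ≤ 0 → listWeight halfWeight l ≤ 4)
      (hfour L hL) i ((listWeight_le (fun n _ => outsideWeight_nonneg L.1 n) hi).trans hout))
    omega

theorem exists_pos_of_weight_pos {t : ℕ → ℤ} {Z : Multiset ℕ} (h : 1 ≤ weight t (Z.map atom).sum) :
    ∃ i ∈ Z, 1 ≤ listWeight t (atomList i) := by
  by_contra! hno
  have := weight_sum_le_mul (t := t) (Z := Z) (b := 0) fun i hi => by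
    have := hno i hi
    omega
  omega

/-! ### Twin leaves -/

/-- Numerical description of the factorizations of sequences over `0, g + h, ±g` and at most once each
of `h` and `-h`; the number `q` counts how often `h + (-h)` is used. -/
theorem exists_count_inverse {f : ℕ × ℕ} (hf : f ∈ frames) {Z : Multiset ℕ}
    (h1 : ∀ i ∈ Z, listWeight (frameWeight f.1 f.2 [0, 0, 0, 0, 0, 1, 2]) (atomList i) ≤ 1)
    (h2 : ∀ i ∈ Z, listWeight (frameWeight f.1 f.2 [0, 0, 0, 0, 1, 0, 2]) (atomList i) ≤ 1) :
    ∃ q : ℕ, (weight (frameWeight f.1 f.2 [4, 2, 1, 3, 1, 7, 0]) (Z.map atom).sum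
        - 4 * (Z.card - q)) % 8 = 0 ∧
      weight (frameWeight f.1 f.2 [4, 2, 1, 1, -1, -1, 0]) (Z.map atom).sum ≤ 4 * Z.card - 6 * q ∧
      q ≤ weight (frameWeight f.1 f.2 [0, 0, 0, 0, 1, 0, 2]) (Z.map atom).sum ∧
      2 * Z.card ≤ weight (frameWeight f.1 f.2 [2, 1, 1, 1, 0, 2, 0]) (Z.map atom).sum ∧
      (q = 0 → ∀ i ∈ Z,
        listWeight (frameWeight f.1 f.2 [4, 2, 1, 3, 1, 7, 0]) (atomList i) % 8 = 4) := by
  -- The second alternative is the exceptional atom `h + (-h)`: its parity weight is 0 modulo 8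
  -- rather than 4, and its minimum weight is -2, which is 6 below the general bound 4.
  have hdata : ∀ f ∈ frames, ∀ i < 39,
      listWeight (frameWeight f.1 f.2 [0, 0, 0, 0, 0, 1, 2]) (atomList i) ≤ 1 →
      listWeight (frameWeight f.1 f.2 [0, 0, 0, 0, 1, 0, 2]) (atomList i) ≤ 1 →
      2 ≤ listWeight (frameWeight f.1 f.2 [2, 1, 1, 1, 0, 2, 0]) (atomList i) ∧
      0 ≤ listWeight (frameWeight f.1 f.2 [0, 0, 0, 0, 1, 0, 2]) (atomList i) ∧
      ((listWeight (frameWeight f.1 f.2 [4, 2, 1, 3, 1, 7, 0]) (atomList i) % 8 = 4 ∧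
        listWeight (frameWeight f.1 f.2 [4, 2, 1, 1, -1, -1, 0]) (atomList i) ≤ 4) ∨
      (listWeight (frameWeight f.1 f.2 [4, 2, 1, 3, 1, 7, 0]) (atomList i) % 8 = 0 ∧
        listWeight (frameWeight f.1 f.2 [4, 2, 1, 1, -1, -1, 0]) (atomList i) ≤ -2 ∧
        1 ≤ listWeight (frameWeight f.1 f.2 [0, 0, 0, 0, 1, 0, 2]) (atomList i))) := by
    decide +kernel
  simp only [weight_sum]
  induction Z using Multiset.induction with
  | empty => exact ⟨0, by simp⟩
  | cons i Z ih =>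
    obtain ⟨q, e1, e2, e3, e4, e5⟩ := ih (fun j hj => h1 j (Multiset.mem_cons_of_mem hj))
      (fun j hj => h2 j (Multiset.mem_cons_of_mem hj))
    have hi := forall_atomList (p := fun l =>
      listWeight (frameWeight f.1 f.2 [0, 0, 0, 0, 0, 1, 2]) l ≤ 1 →
      listWeight (frameWeight f.1 f.2 [0, 0, 0, 0, 1, 0, 2]) l ≤ 1 →
      2 ≤ listWeight (frameWeight f.1 f.2 [2, 1, 1, 1, 0, 2, 0]) l ∧
      0 ≤ listWeight (frameWeight f.1 f.2 [0, 0, 0, 0, 1, 0, 2]) l ∧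
      ((listWeight (frameWeight f.1 f.2 [4, 2, 1, 3, 1, 7, 0]) l % 8 = 4 ∧
        listWeight (frameWeight f.1 f.2 [4, 2, 1, 1, -1, -1, 0]) l ≤ 4) ∨
      (listWeight (frameWeight f.1 f.2 [4, 2, 1, 3, 1, 7, 0]) l % 8 = 0 ∧
        listWeight (frameWeight f.1 f.2 [4, 2, 1, 1, -1, -1, 0]) l ≤ -2 ∧
        1 ≤ listWeight (frameWeight f.1 f.2 [0, 0, 0, 0, 1, 0, 2]) l))) (hdata f hf) i
      (h1 i (Multiset.mem_cons_self _ _)) (h2 i (Multiset.mem_cons_self _ _))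
    simp only [Multiset.map_cons, Multiset.sum_cons, Multiset.card_cons, Multiset.forall_mem_cons]
    push_cast
    obtain ⟨hi1, hi2, ⟨hi3, hi4⟩ | ⟨hi3, hi4, hi5⟩⟩ := hi
    · exact ⟨q, by omega, by omega, by omega, by omega, fun h0 => ⟨hi3, e5 h0⟩⟩
    · exact ⟨q + 1, by push_cast; omega, by push_cast; omega, by push_cast; omega, by omega,
        fun h0 => absurd h0 (by omega)⟩

-- If `h` and `-h` lie in different atoms, those two atoms can be exchanged for three or four. Hence
-- a longest factorization must use `h + (-h)`.
set_option synthInstance.maxSize 1000 in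
theorem testBit_of_twin : ∀ f ∈ frames, ∀ i < 38,
    1 ≤ listWeight (frameWeight f.1 f.2 [0, 0, 0, 0, 1, 0, 0]) (atomList i) →
    listWeight (frameWeight f.1 f.2 [0, 0, 0, 0, 0, 1, 2]) (atomList i) ≤ 1 →
    listWeight (frameWeight f.1 f.2 [0, 0, 0, 0, 1, 0, 2]) (atomList i) ≤ 1 →
    listWeight (frameWeight f.1 f.2 [4, 2, 1, 3, 1, 7, 0]) (atomList i) % 8 = 4 → ∀ j < 38,
    1 ≤ listWeight (frameWeight f.1 f.2 [0, 0, 0, 0, 0, 1, 0]) (atomList j) →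
    listWeight (frameWeight f.1 f.2 [0, 0, 0, 0, 0, 1, 2]) (atomList j) ≤ 1 →
    listWeight (frameWeight f.1 f.2 [0, 0, 0, 0, 1, 0, 2]) (atomList j) ≤ 1 →
    listWeight (frameWeight f.1 f.2 [4, 2, 1, 3, 1, 7, 0]) (atomList j) % 8 = 4 →
    i ≠ j ∧ (doubleGainMasks.getD i 0).testBit j = true := by
  decide +kernel

theorem pair_le_of_mem {Z : Multiset ℕ} {i j : ℕ} (hij : i ≠ j) (hi : i ∈ Z) (hj : j ∈ Z) :
    ({i, j} : Multiset ℕ) ≤ Z := by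
  obtain ⟨Y, rfl⟩ := Multiset.exists_cons_of_mem hi
  have hjY : j ∈ Y := (Multiset.mem_cons.1 hj).resolve_left hij.symm
  exact Multiset.cons_le_cons i (Multiset.singleton_le.2 hjY)

theorem exists_longer_of_testBit {Z : Multiset ℕ} {i j : ℕ}
    (h : (doubleGainMasks.getD i 0).testBit j = true) (hle : ({i, j} : Multiset ℕ) ≤ Z) :
    ∃ m ∈ lengthSet (Z.map atom).sum, Z.card < m := by
  rw [doubleGainMasks_eq] at h
  obtain ⟨r, hr, hr'⟩ := exists_of_testBit_getD h
  rcases List.mem_append.1 hr with hr | hr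
  · exact ⟨_, card_add_one_mem hr (hr' ▸ hle), by omega⟩
  · exact ⟨_, card_add_two_mem hr (hr' ▸ hle), by omega⟩

/-- The lengths of a sequence over `0, g + h, ±g` and at most once each of `h` and `-h`, if a certain
weight attains the value that belongs to the length `k`. -/
theorem twin_lengths {f : ℕ × ℕ} (hf : f ∈ frames) {A : Multiset (ZMod 2 × ZMod 4)} {k : ℕ}
    (h1 : weight (frameWeight f.1 f.2 [0, 0, 0, 0, 0, 1, 2]) A ≤ 1)
    (h2 : weight (frameWeight f.1 f.2 [0, 0, 0, 0, 1, 0, 2]) A ≤ 1)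
    (hmin : 4 * k ≤ weight (frameWeight f.1 f.2 [4, 2, 1, 1, -1, -1, 0]) A)
    (hpar : (weight (frameWeight f.1 f.2 [4, 2, 1, 3, 1, 7, 0]) A - 4 * k) % 8 = 0)
    (hmax : weight (frameWeight f.1 f.2 [2, 1, 1, 1, 0, 2, 0]) A ≤ 4 * k + 2) :
    k + 1 ∉ lengthSet A ∧ (∀ l ∈ lengthSet A, k ≤ l ∧ l ≤ 2 * k + 1) ∧
    (1 ≤ weight (frameWeight f.1 f.2 [0, 0, 0, 0, 1, 0, 0]) A →
      1 ≤ weight (frameWeight f.1 f.2 [0, 0, 0, 0, 0, 1, 0]) A →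
      ∀ l ∈ lengthSet A, (∀ m ∈ lengthSet A, m ≤ l) → l % 2 ≠ k % 2) := by
  have key : ∀ Z : Multiset ℕ, (Z.map atom).sum = A → ∃ q : ℕ,
      (weight (frameWeight f.1 f.2 [4, 2, 1, 3, 1, 7, 0]) A - 4 * (Z.card - q)) % 8 = 0 ∧
      weight (frameWeight f.1 f.2 [4, 2, 1, 1, -1, -1, 0]) A ≤ 4 * Z.card - 6 * q ∧
      q ≤ weight (frameWeight f.1 f.2 [0, 0, 0, 0, 1, 0, 2]) A ∧
      2 * Z.card ≤ weight (frameWeight f.1 f.2 [2, 1, 1, 1, 0, 2, 0]) A ∧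
      (q = 0 → ∀ i ∈ Z,
        listWeight (frameWeight f.1 f.2 [4, 2, 1, 3, 1, 7, 0]) (atomList i) % 8 = 4) := by
    rintro Z rfl
    exact exists_count_inverse hf
      (fun i hi => (listWeight_le (fun n _ => frameWeight_nonneg (by simp) n) hi).trans h1)
      (fun i hi => (listWeight_le (fun n _ => frameWeight_nonneg (by simp) n) hi).trans h2)
  refine ⟨?_, ?_, ?_⟩
  · rintro ⟨Z, hZ, hcard⟩
    -- Length `k + 1` would force `q` to be odd, hence 1, and then `4 * k ≤ 4 * (k + 1) - 6`.
    obtain ⟨q, e1, e2, e3, e4, -⟩ := key Z hZ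
    omega
  · rintro l ⟨Z, hZ, rfl⟩
    obtain ⟨q, e1, e2, e3, e4, -⟩ := key Z hZ
    omega
  · rintro hh hh' l ⟨Z, rfl, rfl⟩ hl
    obtain ⟨q, e1, e2, e3, e4, e5⟩ := key Z rfl
    -- For `q = 1` the length differs from `k` in parity; for `q = 0` an exchange gives a longer
    -- factorization.
    by_cases hq : q = 0
    swap
    · omega
    exfalso
    obtain ⟨i, hi, hi1⟩ := exists_pos_of_weight_pos hh
    obtain ⟨j, hj, hj1⟩ := exists_pos_of_weight_pos hh'
    have hlt : ∀ f ∈ frames, ¬ 1 ≤ listWeight (frameWeight f.1 f.2 [0, 0, 0, 0, 1, 0, 0]) (atomList 38) ∧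
        ¬ 1 ≤ listWeight (frameWeight f.1 f.2 [0, 0, 0, 0, 0, 1, 0]) (atomList 38) := by
      decide +kernel
    have hi38 : i < 38 := by
      by_contra! h38
      rw [atomList_of_le h38] at hi1
      exact (hlt f hf).1 hi1
    have hj38 : j < 38 := by
      by_contra! h38
      rw [atomList_of_le h38] at hj1
      exact (hlt f hf).2 hj1
    have hpos1 : ∀ n < 8, 0 ≤ frameWeight f.1 f.2 [0, 0, 0, 0, 0, 1, 2] n :=
      fun n _ => frameWeight_nonneg (by simp) n
    have hpos2 : ∀ n < 8, 0 ≤ frameWeight f.1 f.2 [0, 0, 0, 0, 1, 0, 2] n :=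
      fun n _ => frameWeight_nonneg (by simp) n
    obtain ⟨hij, hbit⟩ := testBit_of_twin f hf i hi38 hi1 ((listWeight_le hpos1 hi).trans h1)
      ((listWeight_le hpos2 hi).trans h2) (e5 hq i hi) j hj38 hj1
      ((listWeight_le hpos1 hj).trans h1) ((listWeight_le hpos2 hj).trans h2) (e5 hq j hj)
    obtain ⟨m, hm, hlt⟩ := exists_longer_of_testBit hbit (pair_le_of_mem hij hi hj)
    have := hl m hm
    omega

theorem mem_map_idx_of_mem {Z : Multiset ℕ} {i n : ℕ} (hi : i ∈ Z) (hn : n ∈ atomList i) :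
    n ∈ ((Z.map atom).sum).map idx := by
  have h := Multiset.map_le_map (f := idx) (atom_le_sum hi)
  rw [map_idx_atom] at h
  exact Multiset.mem_of_le h hn

/-- If `h` or `-h` is absent, `hasParity_of_single` applies to the frame `(g, h)` or `(-g, -h)`.
Otherwise both atoms of length five occur, they supply the full support, and `twin_lengths` applies
with `k = Z.card`. -/
theorem twin_bounds {Z : Multiset ℕ} {L : ℕ × ℕ × List (ℕ × ℕ)} (hL : L ∈ twinLeaves)
    (hc : ∀ c ∈ L.2.2, cost c.1 Z ≤ c.2) : HasParity (Z.map atom).sum ∨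
      (HasFullSupport (Z.map atom).sum ∧ ∀ l ∈ lengthSet (Z.map atom).sum,
        Z.card ≤ l ∧ l ≤ 2 * Z.card + 1 ∧
        ((∀ m ∈ lengthSet (Z.map atom).sum, m ≤ l) → l % 2 ≠ Z.card % 2)) := by
  have hframe : ∀ L ∈ twinLeaves, (L.1, L.2.1) ∈ frames ∧ (negIdx L.1, negIdx L.2.1) ∈ frames ∧
      (∀ n ∈ [1, 3, 5, 7], n ∈ [L.1, negIdx L.1, L.2.1, negIdx L.2.1]) ∧
      addIdx L.1 L.2.1 ∈ [4, 6] ∧ (∀ n < 8, frameWeight (negIdx L.1) (negIdx L.2.1)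
        [0, 0, 0, 0, 0, 1, 2] n = 1 * frameWeight L.1 L.2.1 [0, 0, 0, 0, 1, 0, 2] n) ∧
      (∀ n < 8, frameWeight (negIdx L.1) (negIdx L.2.1)
        [0, 0, 0, 0, 2, 0, 0] n = 2 * frameWeight L.1 L.2.1 [0, 0, 0, 0, 0, 1, 0] n) ∧
      (∀ n < 8, frameWeight L.1 L.2.1
        [0, 0, 0, 0, 2, 0, 0] n = 2 * frameWeight L.1 L.2.1 [0, 0, 0, 0, 1, 0, 0] n) := by
    decide +kernel
  have hmem : ∀ L ∈ twinLeaves, ∃ c d, L.2.2 = [(c, 1), (d, 1)] := by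
    simp [twinLeaves]
  have hdata : ∀ L ∈ twinLeaves, ∀ i < 39,
      listWeight (frameWeight L.1 L.2.1 [0, 0, 0, 0, 0, 1, 2]) (atomList i)
        ≤ 0 + 1 * digit (L.2.2.getD 0 0).1 i ∧
      listWeight (frameWeight L.1 L.2.1 [0, 0, 0, 0, 1, 0, 2]) (atomList i)
        ≤ 0 + 1 * digit (L.2.2.getD 1 0).1 i ∧
      listWeight (frameWeight L.1 L.2.1 [2, 1, 1, 1, 0, 2, 0]) (atomList i)
        ≤ 4 + 2 * digit (L.2.2.getD 0 0).1 i := by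
    decide +kernel
  -- The minimum weight is at least 4 on each permitted atom, which makes `Z` a factorization of
  -- minimal length.
  have hsmall : ∀ L ∈ twinLeaves, ∀ i < 39, digit (L.2.2.getD 0 0).1 i ≤ 1 →
      4 ≤ listWeight (frameWeight L.1 L.2.1 [4, 2, 1, 1, -1, -1, 0]) (atomList i) ∧
      listWeight (frameWeight L.1 L.2.1 [4, 2, 1, 3, 1, 7, 0]) (atomList i) % 8 = 4 := by
    decide +kernel
  have hsupp : ∀ L ∈ twinLeaves, ∀ i < 39, digit (L.2.2.getD 0 0).1 i ≤ 1 →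
      (1 ≤ listWeight (frameWeight L.1 L.2.1 [0, 0, 0, 0, 1, 0, 0]) (atomList i) →
        ∀ n ∈ [addIdx L.1 L.2.1, negIdx L.1, L.2.1], n ∈ atomList i) ∧
      (1 ≤ listWeight (frameWeight L.1 L.2.1 [0, 0, 0, 0, 0, 1, 0]) (atomList i) →
        ∀ n ∈ [L.1, negIdx L.2.1], n ∈ atomList i) := by
    decide +kernel
  obtain ⟨hf, hf', hord, hadd, hw1, hw2, hw3⟩ := hframe L hL
  obtain ⟨c, d, hcd⟩ := hmem L hL
  have hcc : cost c Z ≤ 1 := hc (c, 1) (by rw [hcd]; simp)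
  have hcd' : cost d Z ≤ 1 := hc (d, 1) (by rw [hcd]; simp)
  replace hdata := hdata L hL
  replace hsmall := hsmall L hL
  replace hsupp := hsupp L hL
  simp only [hcd, List.getD_cons_zero, List.getD_cons_succ] at hdata hsmall hsupp
  have hZ : ∀ i ∈ Z, digit c i ≤ 1 := fun i hi => (digit_le_cost hi).trans hcc
  have h1 := weight_sum_le_cost (Z := Z) fun i _ => (forall_atomList_digit
    (p := fun l d => listWeight (frameWeight L.1 L.2.1 [0, 0, 0, 0, 0, 1, 2]) l ≤ 0 + 1 * d)
    (fun i hi => (hdata i hi).1) i)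
  have h2 := weight_sum_le_cost (Z := Z) fun i _ => (forall_atomList_digit
    (p := fun l d => listWeight (frameWeight L.1 L.2.1 [0, 0, 0, 0, 1, 0, 2]) l ≤ 0 + 1 * d)
    (fun i hi => (hdata i hi).2.1) i)
  have h3 := weight_sum_le_cost (Z := Z) fun i _ => (forall_atomList_digit
    (p := fun l d => listWeight (frameWeight L.1 L.2.1 [2, 1, 1, 1, 0, 2, 0]) l ≤ 4 + 2 * d)
    (fun i hi => (hdata i hi).2.2) i)
  have hs : ∀ i ∈ Z, _ := fun i hi => forall_atomList_digit (p := fun l d => d ≤ 1 →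
    4 ≤ listWeight (frameWeight L.1 L.2.1 [4, 2, 1, 1, -1, -1, 0]) l ∧
      listWeight (frameWeight L.1 L.2.1 [4, 2, 1, 3, 1, 7, 0]) l % 8 = 4) hsmall i (hZ i hi)
  have h4 := mul_le_weight_sum fun i hi => (hs i hi).1
  have h5 := weight_sum_mod_eight fun i hi => (hs i hi).2
  have hcongr : ∀ {t u : ℕ → ℤ} {a : ℤ}, (∀ n < 8, t n = a * u n) →
      ∀ A, weight t A = a * weight u A := by
    intro t u a htu A
    rw [weight, weight, ← Multiset.sum_map_mul_left]
    refine congrArg _ (Multiset.map_congr rfl fun n hn => ?_)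
    obtain ⟨x, -, rfl⟩ := Multiset.mem_map.1 hn
    exact htu _ (idx_lt x)
  have hnn := weight_nonneg (t := frameWeight L.1 L.2.1 [0, 0, 0, 0, 1, 0, 0])
    (fun n _ => frameWeight_nonneg (by simp) n) (Z.map atom).sum
  have hnn' := weight_nonneg (t := frameWeight L.1 L.2.1 [0, 0, 0, 0, 0, 1, 0])
    (fun n _ => frameWeight_nonneg (by simp) n) (Z.map atom).sum
  have hw1' := hcongr hw1 (Z.map atom).sum
  have hw2' := hcongr hw2 (Z.map atom).sum
  have hw3' := hcongr hw3 (Z.map atom).sum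
  by_cases hh : 1 ≤ weight (frameWeight L.1 L.2.1 [0, 0, 0, 0, 1, 0, 0]) (Z.map atom).sum
  swap
  · exact Or.inl (hasParity_of_single _ hf _ (by dsimp only; omega) (by dsimp only; omega))
  by_cases hh' : 1 ≤ weight (frameWeight L.1 L.2.1 [0, 0, 0, 0, 0, 1, 0]) (Z.map atom).sum
  swap
  · exact Or.inl (hasParity_of_single _ hf' _ (by dsimp only; omega) (by dsimp only; omega))
  refine Or.inr ⟨?_, fun l hl => ?_⟩
  · have hsup : ∀ i ∈ Z, _ := fun i hi => forall_atomList_digit (p := fun l d => d ≤ 1 →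
      (1 ≤ listWeight (frameWeight L.1 L.2.1 [0, 0, 0, 0, 1, 0, 0]) l →
        ∀ n ∈ [addIdx L.1 L.2.1, negIdx L.1, L.2.1], n ∈ l) ∧
      (1 ≤ listWeight (frameWeight L.1 L.2.1 [0, 0, 0, 0, 0, 1, 0]) l →
        ∀ n ∈ [L.1, negIdx L.2.1], n ∈ l)) hsupp i (hZ i hi)
    obtain ⟨i, hi, hi1⟩ := exists_pos_of_weight_pos hh
    obtain ⟨j, hj, hj1⟩ := exists_pos_of_weight_pos hh'
    have hin : ∀ n ∈ [addIdx L.1 L.2.1, negIdx L.1, L.2.1], n ∈ ((Z.map atom).sum).map idx :=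
      fun n hn => mem_map_idx_of_mem hi ((hsup i hi).1 hi1 n hn)
    have hjn : ∀ n ∈ [L.1, negIdx L.2.1], n ∈ ((Z.map atom).sum).map idx :=
      fun n hn => mem_map_idx_of_mem hj ((hsup j hj).2 hj1 n hn)
    refine ⟨fun n hn => ?_, _, hadd, hin _ (by simp)⟩
    have hn' := hord n hn
    simp only [List.mem_cons, List.not_mem_nil, or_false] at hn'
    rcases hn' with rfl | rfl | rfl | rfl
    · exact hjn _ (by simp)
    · exact hin _ (by simp)
    · exact hin _ (by simp)
    · exact hjn _ (by simp)
  · obtain ⟨-, hb, hp⟩ := twin_lengths hf (A := (Z.map atom).sum) (k := Z.card) (by dsimp only; omega)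
      (by dsimp only; omega) (by dsimp only; omega) (by dsimp only; omega) (by dsimp only; omega)
    exact ⟨(hb l hl).1, (hb l hl).2, hp hh hh' l hl⟩

/-! ### Positions of gaps and extremal restrictions -/

/-- If both were missing, a vertex leaf would make `k` the maximal length. -/
theorem add_one_or_add_two_mem {A : Multiset (ZMod 2 × ZMod 4)} {k l : ℕ} (hk : k ∈ lengthSet A)
    (hl : l ∈ lengthSet A) (hkl : k < l) : k + 1 ∈ lengthSet A ∨ k + 2 ∈ lengthSet A := by
  obtain ⟨Z, rfl, rfl⟩ := hk
  by_contra! h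
  obtain ⟨leaf, hleaf, hc⟩ := exists_vertexLeaf h.1 h.2
  have := le_card_of_vertexLeaf hleaf hc l hl
  omega

/-- The possible positions of a gap in a set of lengths. -/
theorem gap_cases {A : Multiset (ZMod 2 × ZMod 4)} {k M : ℕ} (hk : k ∈ lengthSet A)
    (hM : M ∈ lengthSet A) (hmax : ∀ l ∈ lengthSet A, l ≤ M) (hkM : k < M)
    (h1 : k + 1 ∉ lengthSet A) :
    HasParity A ∨
    (¬ HasFullSupport A ∧ k + 2 = M ∧ ∀ l ∈ lengthSet A, M ≤ 2 * l) ∨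
    (HasFullSupport A ∧ (∀ l ∈ lengthSet A, k ≤ l) ∧ M ≤ 2 * k + 1 ∧ M % 2 ≠ k % 2) := by
  obtain ⟨Z, rfl, rfl⟩ := hk
  have h2 := (add_one_or_add_two_mem ⟨Z, rfl, rfl⟩ hM hkM).resolve_left h1
  obtain ⟨leaf, hleaf, hc⟩ := exists_leaf h1
  simp only [allLeaves, List.mem_append, List.mem_map] at hleaf
  rcases hleaf with h | ⟨L, hL, rfl⟩ | ⟨L, hL, rfl⟩ | ⟨L, hL, rfl⟩ | ⟨L, hL, rfl⟩
  · have := le_card_of_vertexLeaf h hc M hM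
    omega
  · exact Or.inl (hasParity_of_singleLeaf hL hc)
  · obtain ⟨hfull, hb⟩ := balanced_bounds hL hc
    have := (hb M hM).1
    -- Now `k + 2 ≤ M ≤ k + 2`.
    have := hmax _ h2
    exact Or.inr (Or.inl ⟨hfull, by omega, (hb M hM).2⟩)
  · exact Or.inl (hasParity_of_inverseLeaf hL hc)
  · rcases twin_bounds hL hc with h | ⟨hfull, hb⟩
    · exact Or.inl h
    · exact Or.inr (Or.inr ⟨hfull, fun l hl => (hb l hl).1, (hb M hM).2.1, (hb M hM).2.2 hmax⟩)

theorem two_mul_le_five_mul {A : Multiset (ZMod 2 × ZMod 4)} {k l : ℕ} (hk : k ∈ lengthSet A)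
    (hl : l ∈ lengthSet A) : 2 * l ≤ 5 * k := by
  have h1 := two_mul_le_halfWeight hl
  have h2 := halfWeight_le_five_mul hk
  omega

theorem eq_one_of_one_mem {A : Multiset (ZMod 2 × ZMod 4)} {l : ℕ} (h1 : 1 ∈ lengthSet A)
    (hl : l ∈ lengthSet A) : l = 1 := by
  obtain ⟨Z, hZ, hcard⟩ := h1
  obtain ⟨i, rfl⟩ := Multiset.card_eq_one.1 hcard
  obtain rfl : atom i = A := by simpa using hZ
  obtain ⟨Y, hY, rfl⟩ := hl
  have hY0 : Y ≠ 0 := by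
    rintro rfl
    exact atom_ne_zero i (by simpa using hY.symm)
  obtain ⟨j, hj⟩ := Multiset.exists_mem_of_ne_zero hY0
  obtain ⟨Y', rfl⟩ := Multiset.exists_cons_of_mem hj
  have hji := eq_of_le_atom (hY ▸ atom_le_sum hj) (sum_atom j) (atom_ne_zero j)
  rw [Multiset.map_cons, Multiset.sum_cons, hji, add_eq_left] at hY
  have : Y' = 0 := by
    by_contra h0
    obtain ⟨m, hm⟩ := Multiset.exists_mem_of_ne_zero h0
    exact atom_ne_zero m (Multiset.sum_eq_zero_iff.1 hY _ (Multiset.mem_map_of_mem _ hm))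
  simp [this]

/-- Two atoms of length five whose sum may be a sum of five atoms satisfy the hypotheses of
`twin_lengths` for `k = 2`. -/
def IsTwinPair (l l' : List ℕ) : Prop :=
  listWeight halfWeight l = 5 → listWeight halfWeight l' = 5 →
    (∀ w ∈ vertexWeights, 20 ≤ listWeight (tableWeight w) l + listWeight (tableWeight w) l') →
    ∃ f ∈ frames,
      listWeight (frameWeight f.1 f.2 [0, 0, 0, 0, 0, 1, 2]) l
        + listWeight (frameWeight f.1 f.2 [0, 0, 0, 0, 0, 1, 2]) l' ≤ 1 ∧
      listWeight (frameWeight f.1 f.2 [0, 0, 0, 0, 1, 0, 2]) l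
        + listWeight (frameWeight f.1 f.2 [0, 0, 0, 0, 1, 0, 2]) l' ≤ 1 ∧
      listWeight (frameWeight f.1 f.2 [4, 2, 1, 1, -1, -1, 0]) l
        + listWeight (frameWeight f.1 f.2 [4, 2, 1, 1, -1, -1, 0]) l' = 8 ∧
      (listWeight (frameWeight f.1 f.2 [4, 2, 1, 3, 1, 7, 0]) l
        + listWeight (frameWeight f.1 f.2 [4, 2, 1, 3, 1, 7, 0]) l') % 8 = 0 ∧
      listWeight (frameWeight f.1 f.2 [2, 1, 1, 1, 0, 2, 0]) l
        + listWeight (frameWeight f.1 f.2 [2, 1, 1, 1, 0, 2, 0]) l' ≤ 10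

instance (l l' : List ℕ) : Decidable (IsTwinPair l l') := by
  unfold IsTwinPair
  infer_instance

theorem isTwinPair_atomList (i j : ℕ) : IsTwinPair (atomList i) (atomList j) := by
  have h : ∀ i < 39, ∀ j < 39, IsTwinPair (atomList i) (atomList j) := by
    decide +kernel
  exact forall_atomList (p := fun l => IsTwinPair l (atomList j))
    (fun i hi => forall_atomList (h i hi) j) i

/-- Length 5 forces half weight at least 10, so both atoms have length five, and it forces every
vertex weight to be at least 20. All such pairs satisfy the hypotheses of `twin_lengths` with `k =
2`, which excludes `k + 1 = 3`. -/
theorem three_notMem {A : Multiset (ZMod 2 × ZMod 4)} (h2 : 2 ∈ lengthSet A) (h5 : 5 ∈ lengthSet A) :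
    3 ∉ lengthSet A := by
  obtain ⟨Z, rfl, hZ⟩ := h2
  obtain ⟨i, j, rfl⟩ := Multiset.card_eq_two.1 hZ
  have hle : ∀ i, listWeight halfWeight (atomList i) ≤ 5 :=
    forall_atomList (p := fun l => listWeight halfWeight l ≤ 5) (by decide +kernel)
  have hw : ∀ t, weight t (({i, j} : Multiset ℕ).map atom).sum
      = listWeight t (atomList i) + listWeight t (atomList j) := by
    intro t
    rw [weight_sum]
    simp
  have h10 := two_mul_le_halfWeight h5
  rw [hw] at h10
  have hi := hle i
  have hj := hle j
  obtain ⟨f, hf, e1, e2, e3, e4, e5⟩ := isTwinPair_atomList i j (by omega) (by omega) fun w hwm => by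
    have := four_mul_le_weight hwm h5
    rw [hw] at this
    omega
  rw [← hw] at e1 e2 e3 e4 e5
  exact (twin_lengths hf (k := 2) e1 e2 (by omega) (by omega) (by omega)).1

/-! ### The families in terms of minimum and maximum -/

theorem Icc_subset_of_step {L : Set ℕ} {m M : ℕ} (hm : m ∈ L)
    (step : ∀ k ∈ L, m ≤ k → k < M → k + 1 ∈ L) : Set.Icc m M ⊆ L := by
  rintro x ⟨hx1, hx2⟩
  induction x, hx1 using Nat.le_induction with
  | base => exact hm
  | succ x hx ih => exact step x (ih (by omega)) hx (by omega)

theorem shift_Icc (y a b : ℕ) : shift y (Set.Icc a b) = Set.Icc (y + a) (y + b) := by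
  simp [shift]

theorem ceil_div_three (k : ℕ) : ⌈(k : ℚ) / 3⌉₊ = (k + 2) / 3 := by
  refine eq_of_forall_ge_iff fun c => ?_
  rw [Nat.ceil_le, div_le_iff₀ (by norm_num)]
  have : (k : ℚ) ≤ c * 3 ↔ k ≤ c * 3 := by exact_mod_cast Iff.rfl
  rw [this]
  omega

theorem ceil_two_mul_div_three (k : ℕ) : ⌈(2 * k : ℚ) / 3⌉₊ = (2 * k + 2) / 3 := by
  have := ceil_div_three (2 * k)
  push_cast at this
  exact this

/-- The elasticity bound together with two exceptions is a normal form for the intervals; `family2'`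
has the same one, which proves that the two descriptions agree. -/
theorem mem_family2_iff {L : Set ℕ} : L ∈ family2 ↔
    ∃ m M, m < M ∧ 2 * M ≤ 5 * m ∧ m ≠ 1 ∧ ¬ (m = 2 ∧ M = 5) ∧ L = Set.Icc m M := by
  simp only [family2, Set.mem_union, Set.mem_ofPred_eq, shift_Icc, ceil_div_three]
  constructor
  · rintro ((⟨y, k, hk, hk3, rfl⟩ | ⟨y, rfl⟩) | ⟨t, ht, rfl⟩)
    · exact ⟨_, _, by omega, by omega, by omega, by omega, rfl⟩
    · exact ⟨_, _, by omega, by omega, by omega, by omega, rfl⟩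
    · exact ⟨_, _, by omega, by omega, by omega, by omega, rfl⟩
  · rintro ⟨m, M, h1, h2, h3, h4, rfl⟩
    by_cases h : M = m + 3
    · exact Or.inl (Or.inr ⟨m - 3, by congr 1 <;> omega⟩)
    by_cases h' : 2 * ((M - m + 2) / 3) ≤ m
    · exact Or.inl (Or.inl ⟨m - 2 * ((M - m + 2) / 3), M - m, by omega, by omega,
        by congr 1 <;> omega⟩)
    -- Given `2 * M ≤ 5 * m`, the previous case fails only for `M - m = 3 * t + 1` and `m = 2 * t +
    -- 1`.
    · exact Or.inr ⟨(m - 1) / 2, by omega, by congr 1 <;> omega⟩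

theorem mem_family2'_iff {L : Set ℕ} : L ∈ family2' ↔
    ∃ m M, m < M ∧ 2 * M ≤ 5 * m ∧ m ≠ 1 ∧ ¬ (m = 2 ∧ M = 5) ∧ L = Set.Icc m M := by
  simp only [family2', Set.mem_union, Set.mem_ofPred_eq, shift_Icc, ceil_two_mul_div_three]
  constructor
  · rintro (⟨y, k, hk, hk1, hk3, rfl⟩ | ⟨y, rfl | rfl⟩)
    · exact ⟨_, _, by omega, by omega, by omega, by omega, rfl⟩
    · exact ⟨_, _, by omega, by omega, by omega, by omega, rfl⟩
    · exact ⟨_, _, by omega, by omega, by omega, by omega, rfl⟩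
  · rintro ⟨m, M, h1, h2, h3, h4, rfl⟩
    by_cases h : M = m + 3
    · exact Or.inr ⟨m - 3, Or.inl (by congr 1 <;> omega)⟩
    by_cases h' : M = m + 1
    · exact Or.inr ⟨m - 2, Or.inr (by congr 1 <;> omega)⟩
    exact Or.inl ⟨m - (2 * (M - m) + 2) / 3, M - m, by omega, by omega, by omega,
      by congr 1 <;> omega⟩

theorem family2_eq : family2 = family2' := by
  ext L
  rw [mem_family2_iff, mem_family2'_iff]

theorem mem_family3_iff {L : Set ℕ} : L ∈ family3 ↔
    ∃ m M, m < M ∧ M ≤ 2 * m ∧ M % 2 = m % 2 ∧ L = {x | m ≤ x ∧ x ≤ M ∧ x % 2 = m % 2} := by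
  have hset : ∀ y k, shift y (dilate 2 (Set.Icc 0 k)) =
      {x | y ≤ x ∧ x ≤ y + 2 * k ∧ x % 2 = y % 2} := by
    intro y k
    ext x
    simp only [shift, dilate, Set.mem_image, Set.mem_Icc, Set.mem_ofPred_eq]
    constructor
    · rintro ⟨_, ⟨z, hz, rfl⟩, rfl⟩
      omega
    · intro h
      exact ⟨_, ⟨(x - y) / 2, by omega, rfl⟩, by omega⟩
  simp only [family3, Set.mem_ofPred_eq, hset]
  constructor
  · rintro ⟨y, k, hk, rfl⟩
    exact ⟨_, _, by omega, by omega, by omega, rfl⟩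
  · rintro ⟨m, M, h1, h2, h3, rfl⟩
    refine ⟨2 * m - M, (M - m) / 2, by omega, ?_⟩
    rw [show 2 * m - M + 2 * ((M - m) / 2) = m by omega, show m + 2 * ((M - m) / 2) = M by omega]

theorem mem_family4_iff {L : Set ℕ} : L ∈ family4 ↔
    ∃ m M, m + 3 ≤ M ∧ M ≤ 2 * m + 1 ∧ M % 2 ≠ m % 2 ∧ L = {m} ∪ Set.Icc (m + 2) M := by
  have hset : ∀ y k, shift y ({0} ∪ Set.Icc 2 k) = {y} ∪ Set.Icc (y + 2) (y + k) := by
    intro y k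
    rw [← shift_Icc, shift, Set.image_union, Set.image_singleton]
    rfl
  simp only [family4, Set.mem_ofPred_eq, hset]
  constructor
  · rintro ⟨y, k, ⟨j, hj⟩, rfl⟩
    exact ⟨_, _, by omega, by omega, by omega, rfl⟩
  · rintro ⟨m, M, h1, h2, h3, rfl⟩
    refine ⟨2 * m + 1 - M, M - m - 2, Nat.odd_iff.2 (by omega), ?_⟩
    rw [show 2 * m + 1 - M + (M - m - 2) + 1 = m by omega, show m + (M - m - 2 + 2) = M by omega]

theorem mem_family5_iff {L : Set ℕ} : L ∈ family5 ↔
    ∃ m M, m + 1 ≤ M ∧ M + 2 ≤ 2 * m ∧ L = Set.Icc m M ∪ {M + 2} := by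
  have hset : ∀ y k, shift y (Set.Icc 0 k ∪ {k + 2}) = Set.Icc y (y + k) ∪ {y + k + 2} := by
    intro y k
    rw [shift, Set.image_union, Set.image_singleton]
    have := shift_Icc y 0 k
    rw [shift] at this
    rw [this]
    rfl
  simp only [family5, Set.mem_ofPred_eq, hset]
  constructor
  · rintro ⟨y, k, hk, rfl⟩
    exact ⟨_, _, by omega, by omega, rfl⟩
  · rintro ⟨m, M, h1, h2, rfl⟩
    refine ⟨2 * m - M - 2, M - m, by omega, ?_⟩
    rw [show 2 * m - M - 2 + (M - m) + 2 = m by omega, show m + (M - m) = M by omega]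

/-! ### The possible shapes -/

/-- The shapes of the sets of lengths in terms of their minimum and maximum. -/
theorem lengthSet_cases {A : Multiset (ZMod 2 × ZMod 4)} {m M : ℕ} (hm : m ∈ lengthSet A)
    (hM : M ∈ lengthSet A) (hmin : ∀ l ∈ lengthSet A, m ≤ l) (hmax : ∀ l ∈ lengthSet A, l ≤ M) :
    lengthSet A = Set.Icc m M ∨
    (m < M ∧ M ≤ 2 * m ∧ M % 2 = m % 2 ∧ lengthSet A = {x | m ≤ x ∧ x ≤ M ∧ x % 2 = m % 2}) ∨
    (m + 3 ≤ M ∧ M ≤ 2 * m + 1 ∧ M % 2 ≠ m % 2 ∧ lengthSet A = {m} ∪ Set.Icc (m + 2) M) ∨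
    (m + 3 ≤ M ∧ M ≤ 2 * m ∧ lengthSet A = Set.Icc m (M - 2) ∪ {M}) := by
  by_cases hstep : ∀ k ∈ lengthSet A, m ≤ k → k < M → k + 1 ∈ lengthSet A
  · exact Or.inl (Set.Subset.antisymm (fun x hx => ⟨hmin x hx, hmax x hx⟩)
      (Icc_subset_of_step hm hstep))
  push Not at hstep
  obtain ⟨k, hk, hmk, hkM, hk1⟩ := hstep
  by_cases hpar : HasParity A
  · refine Or.inr (Or.inl ⟨by omega, (hpar m hm M hM).2, (hpar M hM m hm).1, ?_⟩)
    ext x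
    refine ⟨fun hx => ⟨hmin x hx, hmax x hx, (hpar x hx m hm).1⟩, ?_⟩
    rintro ⟨hx1, hx2, hx3⟩
    -- With equal parities `add_one_or_add_two_mem` always yields the step 2, so no term of the
    -- progression is skipped.
    obtain ⟨j, rfl⟩ : ∃ j, x = m + 2 * j := ⟨(x - m) / 2, by omega⟩
    clear hx1 hx3
    induction j with
    | zero => exact hm
    | succ j ih =>
      have hj := ih (by omega)
      refine (add_one_or_add_two_mem hj hM (by omega)).resolve_left fun h => ?_
      have := (hpar _ h _ hj).1
      omega
  have hk2 := (add_one_or_add_two_mem hk hM hkM).resolve_left hk1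
  -- Full support decides the kind of this gap, and the same kind applies to every other gap.
  rcases (gap_cases hk hM hmax hkM hk1).resolve_left hpar with ⟨hQ, hkM2, hle⟩ | ⟨hQ, hkm, hle, hodd⟩
  · have hsub : Set.Icc m k ⊆ lengthSet A := by
      refine Icc_subset_of_step hm fun l hl _ hlk => ?_
      by_contra hl1
      rcases (gap_cases hl hM hmax (by omega) hl1).resolve_left hpar with ⟨-, h, -⟩ | ⟨h, -⟩
      · omega
      · exact hQ h
    have heq : lengthSet A = Set.Icc m (M - 2) ∪ {M} := by
      rw [show M - 2 = k by omega]
      refine Set.Subset.antisymm (fun x hx => ?_)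
        (Set.union_subset hsub (Set.singleton_subset_iff.2 hM))
      have h1 := hmin x hx
      have h2 := hmax x hx
      have h3 : x ≠ k + 1 := fun h => hk1 (h ▸ hx)
      rcases (by omega : x ≤ k ∨ x = M) with h | h
      · exact Or.inl ⟨h1, h⟩
      · exact Or.inr h
    have hm2 := hle m hm
    -- If the gap starts at the minimum, the set is `{m, m + 2}`, a progression with difference 2.
    rcases hmk.eq_or_lt with rfl | hlt
    · refine Or.inr (Or.inl ⟨by omega, hm2, by omega, ?_⟩)
      rw [heq]
      ext x
      simp only [Set.mem_union, Set.mem_Icc, Set.mem_singleton_iff, Set.mem_ofPred_eq]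
      omega
    · exact Or.inr (Or.inr (Or.inr ⟨by omega, hm2, heq⟩))
  · obtain rfl : k = m := le_antisymm (hkm m hm) hmk
    have hne : M ≠ k + 1 := fun h => hk1 (h ▸ hM)
    refine Or.inr (Or.inr (Or.inl ⟨by omega, hle, hodd, ?_⟩))
    have hsub : Set.Icc (k + 2) M ⊆ lengthSet A := by
      refine Icc_subset_of_step hk2 fun l hl hkl hlM => ?_
      by_contra hl1
      rcases (gap_cases hl hM hmax (by omega) hl1).resolve_left hpar with ⟨h, -⟩ | ⟨-, h, -⟩
      · exact h hQ
      · have := h k hk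
        omega
    refine Set.Subset.antisymm (fun x hx => ?_)
      (Set.union_subset (Set.singleton_subset_iff.2 hk) hsub)
    have h1 := hmin x hx
    have h3 : x ≠ k + 1 := fun h => hk1 (h ▸ hx)
    rcases (by omega : x = k ∨ k + 2 ≤ x) with h | h
    · exact Or.inl h
    · exact Or.inr ⟨h, hmax x hx⟩

theorem lengthSet_mem {A : Multiset (ZMod 2 × ZMod 4)} (hA : A.sum = 0) :
    lengthSet A ∈ family1 ∪ family2 ∪ family3 ∪ family4 ∪ family5 := by
  obtain ⟨k₀, hk₀⟩ := exists_mem_lengthSet hA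
  obtain ⟨m, hm, hmin⟩ : ∃ m ∈ lengthSet A, ∀ l ∈ lengthSet A, m ≤ l :=
    ⟨sInf (lengthSet A), Nat.sInf_mem ⟨k₀, hk₀⟩, fun l hl => Nat.sInf_le hl⟩
  have hbdd : BddAbove (lengthSet A) := ⟨5 * m, fun l hl => by
    have := two_mul_le_five_mul hm hl
    omega⟩
  obtain ⟨M, hM, hmax⟩ : ∃ M ∈ lengthSet A, ∀ l ∈ lengthSet A, l ≤ M :=
    ⟨sSup (lengthSet A), Nat.sSup_mem ⟨k₀, hk₀⟩ hbdd, fun l hl => le_csSup hbdd hl⟩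
  have h25 := two_mul_le_five_mul hm hM
  rcases lengthSet_cases hm hM hmin hmax with h | ⟨h1, h2, h3, h⟩ | ⟨h1, h2, h3, h⟩ | ⟨h1, h2, h⟩
  · rcases (hmin M hM).eq_or_lt with rfl | hlt
    · exact Or.inl (Or.inl (Or.inl (Or.inl ⟨m, by rw [h, Set.Icc_self]⟩)))
    · refine Or.inl (Or.inl (Or.inl (Or.inr (mem_family2_iff.2 ⟨m, M, hlt, h25, ?_, ?_, h⟩))))
      · rintro rfl
        have := eq_one_of_one_mem hm hM
        omega
      · rintro ⟨rfl, rfl⟩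
        exact three_notMem hm hM (h ▸ ⟨by omega, by omega⟩)
  · exact Or.inl (Or.inl (Or.inr (mem_family3_iff.2 ⟨m, M, h1, h2, h3, h⟩)))
  · exact Or.inl (Or.inr (mem_family4_iff.2 ⟨m, M, h1, h2, h3, h⟩))
  · refine Or.inr (mem_family5_iff.2 ⟨m, M - 2, by omega, by omega, ?_⟩)
    rw [h, show M - 2 + 2 = M by omega]

/-! ### Tools for realizing sets of lengths -/

theorem add_mem_lengthSet {A B : Multiset (ZMod 2 × ZMod 4)} {k l : ℕ} (hk : k ∈ lengthSet A)
    (hl : l ∈ lengthSet B) : k + l ∈ lengthSet (A + B) := by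
  obtain ⟨Y, rfl, rfl⟩ := hk
  obtain ⟨Z, rfl, rfl⟩ := hl
  exact ⟨Y + Z, by simp, by simp⟩

theorem mul_mem_lengthSet {A : Multiset (ZMod 2 × ZMod 4)} {k : ℕ} (hk : k ∈ lengthSet A) (t : ℕ) :
    t * k ∈ lengthSet (t • A) := by
  induction t with
  | zero => exact ⟨0, by simp, by simp⟩
  | succ t ih =>
    rw [succ_nsmul, Nat.succ_mul]
    exact add_mem_lengthSet ih hk

/-- The sum of a list of atoms. -/
def atomSum (l : List ℕ) : Multiset (ZMod 2 × ZMod 4) := ((l : Multiset ℕ).map atom).sum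

theorem length_mem_of_sameSum {l l' : List ℕ} (h : sameSum l l' = true) :
    l'.length ∈ lengthSet (atomSum l) :=
  ⟨l', (sum_eq_of_sameSum h).symm, Multiset.coe_card _⟩

theorem weight_atomSum (t : ℕ → ℤ) (l : List ℕ) :
    weight t (atomSum l) = (l.map fun i => listWeight t (atomList i)).sum := by
  rw [atomSum, weight_sum, Multiset.map_coe, Multiset.sum_coe]

theorem sum_atomSum (l : List ℕ) : (atomSum l).sum = 0 := by
  rw [atomSum, ← Multiset.join, Multiset.sum_join, Multiset.map_map]
  exact Multiset.sum_eq_zero fun x hx => by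
    obtain ⟨i, -, rfl⟩ := Multiset.mem_map.1 hx
    exact sum_atom i

/-- The atom `0` is prime: every factorization of `A + {0}` contains it, and cancelling it leaves a
factorization of `A`. -/
theorem lengthSet_add_zero (A : Multiset (ZMod 2 × ZMod 4)) :
    lengthSet (A + {0}) = shift 1 (lengthSet A) := by
  have h38 : atom 38 = {0} := rfl
  ext k
  constructor
  · rintro ⟨Z, hZ, rfl⟩
    have h0 : (0 : ZMod 2 × ZMod 4) ∈ (Z.map atom).join := by
      rw [Multiset.join, hZ]
      simp
    obtain ⟨i, hi, h0i⟩ : ∃ i ∈ Z, (0 : ZMod 2 × ZMod 4) ∈ atom i := by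
      simpa [Multiset.mem_join] using h0
    have hi0 : {0} = atom i := eq_of_le_atom (Multiset.singleton_le.2 h0i) (by simp) (by simp)
    obtain ⟨Y, rfl⟩ := Multiset.exists_cons_of_mem hi
    rw [Multiset.map_cons, Multiset.sum_cons, ← hi0, add_comm A] at hZ
    exact ⟨Y.card, ⟨Y, add_left_cancel hZ, rfl⟩, by simp [add_comm]⟩
  · rintro ⟨l, hl, rfl⟩
    rw [add_comm A]
    exact add_mem_lengthSet ⟨{38}, by simp [h38], rfl⟩ hl

theorem lengthSet_add_nsmul_zero (A : Multiset (ZMod 2 × ZMod 4)) (y : ℕ) :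
    lengthSet (A + y • {0}) = shift y (lengthSet A) := by
  induction y with
  | zero => simp [shift]
  | succ y ih =>
    rw [succ_nsmul, ← add_assoc, lengthSet_add_zero, ih]
    simp only [shift, Set.image_image]
    refine congrArg (· '' _) (funext fun x => ?_)
    omega

theorem shift_mem {A : Multiset (ZMod 2 × ZMod 4)} (hA : A.sum = 0) (y : ℕ) :
    shift y (lengthSet A) ∈ groupSystemOfSetsOfLengths (ZMod 2 × ZMod 4) := by
  refine ⟨⟨A + y • {0}, ?_⟩, ?_⟩
  · change (A + y • {0}).sum = 0
    simp [hA, Multiset.sum_nsmul]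
  · rw [setOfLengths_eq, lengthSet_add_nsmul_zero]

/-- The half weight pins down minimum and maximum. Every other shape has maximum at most `2 * m + 1`
and omits `m + 1` or `M - 1`, so either alternative in `h` leaves only the interval. -/
theorem lengthSet_eq_Icc {A : Multiset (ZMod 2 × ZMod 4)} {m M : ℕ} (hm : m ∈ lengthSet A)
    (hM : M ∈ lengthSet A) (hlow : 5 * (m : ℤ) ≤ weight halfWeight A + 4)
    (hup : weight halfWeight A ≤ 2 * M + 1)
    (h : 2 * m + 2 ≤ M ∨ (m + 1 ∈ lengthSet A ∧ M - 1 ∈ lengthSet A)) :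
    lengthSet A = Set.Icc m M := by
  have hmin : ∀ l ∈ lengthSet A, m ≤ l := fun l hl => by
    have := halfWeight_le_five_mul hl
    omega
  have hmax : ∀ l ∈ lengthSet A, l ≤ M := fun l hl => by
    have := two_mul_le_halfWeight hl
    omega
  rcases lengthSet_cases hm hM hmin hmax with h1 | ⟨h1, h2, h3, h4⟩ | ⟨h1, h2, h3, h4⟩ | ⟨h1, h2, h4⟩
  · exact h1
  all_goals
    rcases h with h | ⟨h5, h6⟩
    · omega
    rw [h4] at h5 h6
    simp only [Set.mem_union, Set.mem_Icc, Set.mem_singleton_iff, Set.mem_ofPred_eq] at h5 h6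
    omega

theorem singleton_mem (y : ℕ) : {y} ∈ groupSystemOfSetsOfLengths (ZMod 2 × ZMod 4) := by
  have h0 : lengthSet 0 = {0} := by
    ext l
    constructor
    · intro hl
      have := two_mul_le_halfWeight hl
      simp only [weight, Multiset.map_zero, Multiset.sum_zero] at this
      rw [Set.mem_singleton_iff]
      omega
    · rintro rfl
      exact ⟨0, rfl, rfl⟩
  have := shift_mem (A := 0) (by simp) y
  rwa [h0, shift, Set.image_singleton, add_zero] at this

/-- An interval is a set of lengths if an interval of the same size with smaller minimum is. -/
theorem Icc_mem_of_lengthSet {A : Multiset (ZMod 2 × ZMod 4)} (hA : A.sum = 0) {m M m' M' : ℕ}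
    (h : lengthSet A = Set.Icc m' M') (hm : m' ≤ m) (hM : M + m' = M' + m) :
    Set.Icc m M ∈ groupSystemOfSetsOfLengths (ZMod 2 × ZMod 4) := by
  have := shift_mem hA (m - m')
  rw [h, shift_Icc] at this
  rwa [show m - m' + m' = m by omega, show m - m' + M' = M by omega] at this

/-- The set of lengths of `t` copies of a sum of two inverse atoms of length five and a remainder. -/
theorem lengthSet_nsmul_add {l : List ℕ} {a b t : ℕ} (ha : a ∈ lengthSet (atomSum l))
    (hb : b ∈ lengthSet (atomSum l)) (hlow : 5 * (a : ℤ) ≤ weight halfWeight (atomSum l) + 4)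
    (hup : weight halfWeight (atomSum l) ≤ 2 * b + 1) (hab : 2 * a + 2 ≤ b + t) :
    lengthSet (t • atomSum [30, 34] + atomSum l) = Set.Icc (t * 2 + a) (t * 5 + b) := by
  have hw : weight halfWeight (atomSum [30, 34]) = 10 := by
    rw [weight_atomSum]
    decide +kernel
  have h2 : 2 ∈ lengthSet (atomSum [30, 34]) :=
    length_mem_of_sameSum (l' := [30, 34]) (by decide +kernel)
  have h5 : 5 ∈ lengthSet (atomSum [30, 34]) :=
    length_mem_of_sameSum (l' := [0, 1, 1, 1, 4]) (by decide +kernel)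
  refine lengthSet_eq_Icc (add_mem_lengthSet (mul_mem_lengthSet h2 t) ha)
    (add_mem_lengthSet (mul_mem_lengthSet h5 t) hb) ?_ ?_ (Or.inl (by omega))
  · rw [weight_add, weight_nsmul, hw]
    push_cast
    omega
  · rw [weight_add, weight_nsmul, hw]
    push_cast
    omega

theorem sum_nsmul_add (t : ℕ) (l l' : List ℕ) : (t • atomSum l + atomSum l').sum = 0 := by
  rw [Multiset.sum_add, Multiset.sum_nsmul, sum_atomSum, sum_atomSum, smul_zero, add_zero]

/-- A single sum of atoms whose set of lengths is an interval. -/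
theorem lengthSet_atomSum_eq_Icc {l l₁ l₂ l₃ : List ℕ}
    (h : (sameSum l l₁ && (sameSum l l₂ && sameSum l l₃)) = true) (h1 : l₁.length = l.length + 1)
    (h2 : l₂.length + 1 = l₃.length)
    (hlow : 5 * (l.length : ℤ) ≤ weight halfWeight (atomSum l) + 4)
    (hup : weight halfWeight (atomSum l) ≤ 2 * l₃.length + 1) :
    lengthSet (atomSum l) = Set.Icc l.length l₃.length := by
  simp only [Bool.and_eq_true] at h
  refine lengthSet_eq_Icc ⟨l, rfl, rfl⟩ (length_mem_of_sameSum h.2.2) hlow hup (Or.inr ⟨?_, ?_⟩)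
  · rw [← h1]
    exact length_mem_of_sameSum h.1
  · rw [← h2]
    exact length_mem_of_sameSum h.2.1

/-! ### Realization of the families -/

theorem family2_mem {L : Set ℕ} (hL : L ∈ family2) :
    L ∈ groupSystemOfSetsOfLengths (ZMod 2 × ZMod 4) := by
  obtain ⟨m, M, h1, h2, h3, h4, rfl⟩ := mem_family2_iff.1 hL
  have hw : ∀ l : List ℕ, weight halfWeight (atomSum l) =
      (l.map fun i => listWeight halfWeight (atomList i)).sum := weight_atomSum _
  have w1 : weight halfWeight (atomSum [7, 8]) = 6 := by rw [hw]; decide +kernel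
  have w2 : weight halfWeight (atomSum [16, 30]) = 9 := by rw [hw]; decide +kernel
  have w3 : weight halfWeight (atomSum [3, 30, 34]) = 12 := by rw [hw]; decide +kernel
  have w4 : weight halfWeight (atomSum [16, 32, 37]) = 14 := by rw [hw]; decide +kernel
  have w5 : weight halfWeight (atomSum [18, 27, 32, 36]) = 18 := by rw [hw]; decide +kernel
  have w0 : weight halfWeight (atomSum []) = 0 := by rw [hw]; rfl
  have w8 : weight halfWeight (atomSum [21, 29]) = 8 := by rw [hw]; decide +kernel
  rcases le_or_gt 6 (M - m) with hk | hk
  -- A copy of `U + (-U)` contributes 3 to the size of the interval, and the remainder adjusts the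
  -- residue modulo 3. The resulting minimum is the least one permitted by `2 * M ≤ 5 * m`. Size at
  -- least 6 is what makes the maximum exceed `2 * m + 1`.
  · obtain ⟨t, ht⟩ : ∃ t, t = (M - m) / 3 := ⟨_, rfl⟩
    rcases (by omega : (M - m) % 3 = 0 ∨ (M - m) % 3 = 1 ∨ (M - m) % 3 = 2) with hr | hr | hr
    · exact Icc_mem_of_lengthSet (sum_nsmul_add t _ _) (lengthSet_nsmul_add (l := []) (a := 0)
        (b := 0) ⟨0, rfl, rfl⟩ ⟨0, rfl, rfl⟩ (by rw [w0]; norm_num) (by rw [w0]; norm_num) (by omega))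
        (by omega) (by omega)
    · exact Icc_mem_of_lengthSet (sum_nsmul_add (t - 1) _ _) (lengthSet_nsmul_add
        (l := [16, 32, 37]) (a := 3) (b := 7) ⟨_, rfl, rfl⟩
        (length_mem_of_sameSum (l' := [0, 1, 1, 2, 4, 4, 4]) (by decide +kernel))
        (by rw [w4]; norm_num) (by rw [w4]; norm_num) (by omega)) (by omega) (by omega)
    · exact Icc_mem_of_lengthSet (sum_nsmul_add t _ _) (lengthSet_nsmul_add
        (l := [21, 29]) (a := 2) (b := 4) ⟨_, rfl, rfl⟩
        (length_mem_of_sameSum (l' := [4, 4, 4, 4]) (by decide +kernel))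
        (by rw [w8]; norm_num) (by rw [w8]; norm_num) (by omega)) (by omega) (by omega)
  · rcases (by omega : M - m = 1 ∨ M - m = 2 ∨ M - m = 3 ∨ M - m = 4 ∨ M - m = 5) with
      hr | hr | hr | hr | hr
    · exact Icc_mem_of_lengthSet (sum_atomSum _) (lengthSet_atomSum_eq_Icc (l := [7, 8])
        (l₁ := [1, 1, 3]) (l₂ := [7, 8]) (l₃ := [1, 1, 3]) (by decide +kernel) rfl rfl
        (by rw [w1]; decide) (by rw [w1]; decide)) (by simp; omega) (by simp; omega)
    · exact Icc_mem_of_lengthSet (sum_atomSum _) (lengthSet_atomSum_eq_Icc (l := [16, 30])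
        (l₁ := [1, 5, 17]) (l₂ := [1, 5, 17]) (l₃ := [0, 1, 1, 6]) (by decide +kernel) rfl rfl
        (by rw [w2]; decide) (by rw [w2]; decide)) (by simp; omega) (by simp; omega)
    -- Since `[2, 5]` is not a set of lengths, the smallest interval of this size is `[3, 6]`; the
    -- summand `2 + 2` closes the gap at 3 in the lengths of `U + (-U)`.
    · exact Icc_mem_of_lengthSet (sum_atomSum _) (lengthSet_atomSum_eq_Icc (l := [3, 30, 34])
        (l₁ := [1, 1, 22, 24]) (l₂ := [0, 1, 4, 7, 8]) (l₃ := [0, 1, 1, 1, 3, 4])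
        (by decide +kernel) rfl rfl
        (by rw [w3]; decide) (by rw [w3]; decide)) (by simp; omega) (by simp; omega)
    · exact Icc_mem_of_lengthSet (sum_atomSum _) (lengthSet_atomSum_eq_Icc (l := [16, 32, 37])
        (l₁ := [0, 1, 33, 37]) (l₂ := [0, 1, 4, 4, 6, 12]) (l₃ := [0, 1, 1, 2, 4, 4, 4])
        (by decide +kernel) rfl rfl
        (by rw [w4]; decide) (by rw [w4]; decide)) (by simp; omega) (by simp; omega)
    · exact Icc_mem_of_lengthSet (sum_atomSum _) (lengthSet_atomSum_eq_Icc (l := [18, 27, 32, 36])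
        (l₁ := [1, 5, 21, 27, 36]) (l₂ := [1, 1, 4, 4, 4, 4, 5, 11])
        (l₃ := [0, 1, 1, 1, 4, 4, 4, 4, 4]) (by decide +kernel) rfl rfl
        (by rw [w5]; decide) (by rw [w5]; decide)) (by simp; omega) (by simp; omega)

/-- The lengths of the sum of `4g` and `4(-g)`. -/
theorem mem_lengthSet_fourfold : 2 ∈ lengthSet (atomSum [14, 15]) ∧ 4 ∈ lengthSet (atomSum [14, 15]) :=
  ⟨length_mem_of_sameSum (l' := [14, 15]) (by decide +kernel),
    length_mem_of_sameSum (l' := [1, 1, 1, 1]) (by decide +kernel)⟩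

/-- Copies of `4g + 4(-g) = 4(g + (-g))` involve only `±g`, so all lengths have the same parity, and
they run from `2 * k` to `4 * k`. -/
theorem family3_mem {L : Set ℕ} (hL : L ∈ family3) :
    L ∈ groupSystemOfSetsOfLengths (ZMod 2 × ZMod 4) := by
  obtain ⟨y, k, hk, rfl⟩ := hL
  obtain ⟨h2, h4⟩ := mem_lengthSet_fourfold
  have hpar : HasParity (k • atomSum [14, 15]) := by
    refine hasParity_of_single (5, 1) (by decide) _ ?_ ?_
    all_goals
      rw [weight_nsmul, weight_atomSum]
    · have : ([14, 15].map fun i => listWeight (frameWeight (5, 1).1 (5, 1).2 [0, 0, 0, 0, 0, 1, 2])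
        (atomList i)).sum = 0 := by decide +kernel
      rw [this]
      simp
    · have : ([14, 15].map fun i => listWeight (frameWeight (5, 1).1 (5, 1).2 [0, 0, 0, 0, 2, 0, 0])
        (atomList i)).sum = 0 := by decide +kernel
      rw [this]
      simp
  have hw : weight halfWeight (k • atomSum [14, 15]) = k * 8 := by
    rw [weight_nsmul, weight_atomSum]
    congr 1
  have hm := mul_mem_lengthSet h2 k
  have hM := mul_mem_lengthSet h4 k
  have hmax : ∀ l ∈ lengthSet (k • atomSum [14, 15]), l ≤ k * 4 := fun l hl => by
    have := two_mul_le_halfWeight hl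
    omega
  have hmin : ∀ l ∈ lengthSet (k • atomSum [14, 15]), k * 2 ≤ l := fun l hl => by
    have := (hpar l hl _ hM).2
    omega
  have hsum : (k • atomSum [14, 15]).sum = 0 := by
    rw [Multiset.sum_nsmul, sum_atomSum, smul_zero]
  have key : lengthSet (k • atomSum [14, 15]) = shift (2 * k) (dilate 2 (Set.Icc 0 k)) := by
    have hset : shift (2 * k) (dilate 2 (Set.Icc 0 k)) =
        {x | k * 2 ≤ x ∧ x ≤ k * 4 ∧ x % 2 = k * 2 % 2} := by
      ext x
      simp only [shift, dilate, Set.mem_image, Set.mem_Icc, Set.mem_ofPred_eq]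
      constructor
      · rintro ⟨_, ⟨z, hz, rfl⟩, rfl⟩
        omega
      · intro h
        exact ⟨_, ⟨(x - 2 * k) / 2, by omega, rfl⟩, by omega⟩
    rw [hset]
    rcases lengthSet_cases hm hM hmin hmax with h | ⟨-, -, -, h⟩ | ⟨-, -, h, -⟩ | ⟨h, -, h'⟩
    · have h1 : k * 2 + 1 ∈ lengthSet (k • atomSum [14, 15]) := h ▸ ⟨by omega, by omega⟩
      have := (hpar _ h1 _ hm).1
      omega
    · exact h
    · omega
    · have h1 : k * 2 + 1 ∈ lengthSet (k • atomSum [14, 15]) := h' ▸ Or.inl ⟨by omega, by omega⟩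
      have := (hpar _ h1 _ hm).1
      omega
  have := shift_mem hsum y
  rw [key] at this
  convert this using 1
  simp only [shift, Set.image_image]
  refine congrArg (· '' _) (funext fun x => ?_)
  omega

theorem family4_mem {L : Set ℕ} (hL : L ∈ family4) :
    L ∈ groupSystemOfSetsOfLengths (ZMod 2 × ZMod 4) := by
  obtain ⟨m, M, h1, h2, h3, rfl⟩ := mem_family4_iff.1 hL
  obtain ⟨j, hj⟩ : ∃ j, M = m + 2 * j + 3 := ⟨(M - m - 3) / 2, by omega⟩
  obtain ⟨A, hA⟩ : ∃ A, A = j • atomSum [14, 15] + atomSum [30, 34] := ⟨_, rfl⟩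
  have hw : ∀ t : ℕ → ℤ, weight t A =
      j * ([14, 15].map fun i => listWeight t (atomList i)).sum +
        ([30, 34].map fun i => listWeight t (atomList i)).sum := fun t => by
    rw [hA, weight_add, weight_nsmul, weight_atomSum, weight_atomSum]
  have hwt : ∀ (w : List ℤ) (a b : ℤ),
      ([14, 15].map fun i => listWeight (frameWeight 5 1 w) (atomList i)).sum = a →
      ([30, 34].map fun i => listWeight (frameWeight 5 1 w) (atomList i)).sum = b →
      weight (frameWeight 5 1 w) A = j * a + b := fun w a b ha hb => by
    rw [hw, ha, hb]
  -- The pairs of constants are the weights of `4g + 4(-g)` and of the two inverse atoms of length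
  -- five, for the frame `g = 5`, `h = 1`.
  obtain ⟨hgap, hmin, -⟩ := twin_lengths (f := (5, 1)) (by decide) (A := A) (k := 2 * j + 2)
    (by rw [hwt _ 0 1 (by decide +kernel) (by decide +kernel)]; omega)
    (by rw [hwt _ 0 1 (by decide +kernel) (by decide +kernel)]; omega)
    (by rw [hwt _ 8 8 (by decide +kernel) (by decide +kernel)]; push_cast; omega)
    (by rw [hwt _ 16 24 (by decide +kernel) (by decide +kernel)]; push_cast; omega)
    (by rw [hwt _ 8 10 (by decide +kernel) (by decide +kernel)]; push_cast; omega)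
  have hm : j * 2 + 2 ∈ lengthSet A := hA ▸ add_mem_lengthSet
    (mul_mem_lengthSet mem_lengthSet_fourfold.1 j) ⟨[30, 34], rfl, rfl⟩
  have hM : j * 4 + 5 ∈ lengthSet A := hA ▸ add_mem_lengthSet
    (mul_mem_lengthSet mem_lengthSet_fourfold.2 j)
    (length_mem_of_sameSum (l' := [0, 1, 1, 1, 4]) (by decide +kernel))
  -- The minimum is even, the maximum is odd and the number after the minimum is missing; only one
  -- shape fits.
  have key : lengthSet A = {j * 2 + 2} ∪ Set.Icc (j * 2 + 2 + 2) (j * 4 + 5) := by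
    rcases lengthSet_cases hm hM (fun l hl => by have := (hmin l hl).1; omega)
      (fun l hl => by have := (hmin l hl).2; omega) with h | ⟨-, -, h, -⟩ | ⟨-, -, -, h⟩ | ⟨-, -, h⟩
    · exact absurd (h ▸ ⟨by omega, by omega⟩) hgap
    · omega
    · exact h
    · exact absurd (h ▸ Or.inl ⟨by omega, by omega⟩) hgap
  have := shift_mem (A := A) (by rw [hA, sum_nsmul_add]) (m - (j * 2 + 2))
  rw [key, shift, Set.image_union, Set.image_singleton, ← shift, shift_Icc] at this
  rwa [show m - (j * 2 + 2) + (j * 2 + 2) = m by omega,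
    show m - (j * 2 + 2) + (j * 2 + 2 + 2) = m + 2 by omega,
    show m - (j * 2 + 2) + (j * 4 + 5) = M by omega] at this

/-- A weight vanishing on the atoms of length two but on no atom of length four, among those that
consist of elements of order four. -/
def quarticWeight : ℕ → ℤ := tableWeight [0, 3, 0, -3, 0, 1, 0, -1]

theorem order_four_atom (i : ℕ) :
    listWeight (outsideWeight [1, 3, 5, 7]) (atomList i) ≤ 0 →
    (listWeight halfWeight (atomList i) = 2 ∧ listWeight quarticWeight (atomList i) = 0) ∨
    (listWeight halfWeight (atomList i) = 4 ∧ listWeight quarticWeight (atomList i) ≠ 0) :=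
  forall_atomList (p := fun l => listWeight (outsideWeight [1, 3, 5, 7]) l ≤ 0 →
    (listWeight halfWeight l = 2 ∧ listWeight quarticWeight l = 0) ∨
    (listWeight halfWeight l = 4 ∧ listWeight quarticWeight l ≠ 0)) (by decide +kernel) i

/-- The half weight exceeds twice the length by 2 for each atom of length four. If there is exactly
one such atom, the quartic weight of the whole sequence is nonzero. -/
theorem order_four_weights {Z : Multiset ℕ}
    (hZ : ∀ i ∈ Z, listWeight (outsideWeight [1, 3, 5, 7]) (atomList i) ≤ 0) :
    2 * (Z.card : ℤ) ≤ weight halfWeight (Z.map atom).sum ∧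
    weight halfWeight (Z.map atom).sum ≤ 4 * Z.card ∧
    (weight halfWeight (Z.map atom).sum = 2 * Z.card → weight quarticWeight (Z.map atom).sum = 0) ∧
    (weight halfWeight (Z.map atom).sum = 2 * Z.card + 2 →
      weight quarticWeight (Z.map atom).sum ≠ 0) := by
  simp only [weight_sum]
  induction Z using Multiset.induction with
  | empty => simp
  | cons i Z ih =>
    obtain ⟨h1, h2, h3, h4⟩ := ih fun j hj => hZ j (Multiset.mem_cons_of_mem hj)
    have hi := order_four_atom i (hZ i (Multiset.mem_cons_self _ _))
    simp only [Multiset.map_cons, Multiset.sum_cons, Multiset.card_cons]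
    push_cast
    omega

/-- Length `2 * m - 1` would need exactly one atom of length four, which the vanishing quartic
weight forbids. The odd length `2 * m - 3` rules out the progression. -/
theorem lengthSet_eq_of_order_four {A : Multiset (ZMod 2 × ZMod 4)} {m : ℕ} (hm3 : 3 ≤ m)
    (hout : weight (outsideWeight [1, 3, 5, 7]) A ≤ 0) (hhalf : weight halfWeight A = 4 * m)
    (hquart : weight quarticWeight A = 0) (hm : m ∈ lengthSet A) (hM : 2 * m ∈ lengthSet A)
    (hodd : 2 * m - 3 ∈ lengthSet A) :
    lengthSet A = Set.Icc m (2 * m - 2) ∪ {2 * m} := by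
  have key : ∀ l ∈ lengthSet A, m ≤ l ∧ l ≤ 2 * m ∧ l ≠ 2 * m - 1 := by
    rintro l ⟨Z, rfl, rfl⟩
    have := order_four_weights (Z := Z) fun i hi =>
      (listWeight_le (fun n _ => outsideWeight_nonneg _ n) hi).trans hout
    omega
  have hgap : 2 * m - 1 ∉ lengthSet A := fun h => (key _ h).2.2 rfl
  rcases lengthSet_cases hm hM (fun l hl => (key l hl).1) (fun l hl => (key l hl).2.1) with
    h | ⟨-, -, h, h'⟩ | ⟨-, -, -, h⟩ | ⟨-, -, h⟩
  · exact absurd (h ▸ ⟨by omega, by omega⟩) hgap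
  · rw [h'] at hodd
    have := hodd.2.2
    omega
  · exact absurd (h ▸ Or.inr ⟨by omega, by omega⟩) hgap
  · exact h

theorem lengthSet_fourfold_add {l : List ℕ} {a : ℕ} (i : ℕ) (ha3 : 3 ≤ a)
    (hout : weight (outsideWeight [1, 3, 5, 7]) (atomSum l) = 0)
    (hhalf : weight halfWeight (atomSum l) = 4 * a)
    (hquart : weight quarticWeight (atomSum l) = 0) (ha : a ∈ lengthSet (atomSum l))
    (hb : 2 * a ∈ lengthSet (atomSum l)) (hodd : 2 * a - 3 ∈ lengthSet (atomSum l)) :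
    lengthSet (i • atomSum [14, 15] + atomSum l) =
      Set.Icc (i * 2 + a) (2 * (i * 2 + a) - 2) ∪ {2 * (i * 2 + a)} := by
  have hw : ∀ (t : ℕ → ℤ) (c : ℤ), ([14, 15].map fun i => listWeight t (atomList i)).sum = c →
      weight t (i • atomSum [14, 15] + atomSum l) = i * c + weight t (atomSum l) := fun t c hc => by
    rw [weight_add, weight_nsmul, weight_atomSum t [14, 15], hc]
  have h4 := mul_mem_lengthSet mem_lengthSet_fourfold.2 i
  refine lengthSet_eq_of_order_four (by omega) ?_ ?_ ?_
    (add_mem_lengthSet (mul_mem_lengthSet mem_lengthSet_fourfold.1 i) ha) ?_ ?_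
  · rw [hw _ 0 (by decide +kernel), hout]
    simp
  · rw [hw _ 8 (by decide +kernel), hhalf]
    push_cast
    ring
  · rw [hw _ 0 (by decide +kernel), hquart]
    simp
  · rw [show 2 * (i * 2 + a) = i * 4 + 2 * a by ring]
    exact add_mem_lengthSet h4 hb
  · rw [show 2 * (i * 2 + a) - 3 = i * 4 + (2 * a - 3) by omega]
    exact add_mem_lengthSet h4 hodd

theorem family5_mem {L : Set ℕ} (hL : L ∈ family5) :
    L ∈ groupSystemOfSetsOfLengths (ZMod 2 × ZMod 4) := by
  obtain ⟨m, M, h1, h2, rfl⟩ := mem_family5_iff.1 hL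
  obtain ⟨A, hA, key⟩ : ∃ A : Multiset (ZMod 2 × ZMod 4), A.sum = 0 ∧
      lengthSet A = Set.Icc (M - m + 2) (2 * (M - m + 2) - 2) ∪ {2 * (M - m + 2)} := by
    -- Each copy of `4g + 4(-g)` raises the minimum by 2, so one base sequence is needed per parity;
    -- the bases have minimum 4 and 3.
    rcases Nat.even_or_odd' (M - m) with ⟨i, hi | hi⟩
    · refine ⟨(i - 1) • atomSum [14, 15] + atomSum [27, 18, 15, 14], sum_nsmul_add _ _ _, ?_⟩
      rw [lengthSet_fourfold_add (a := 4) _ (by omega) (by rw [weight_atomSum]; decide +kernel)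
        (by rw [weight_atomSum]; decide +kernel) (by rw [weight_atomSum]; decide +kernel)
        ⟨_, rfl, rfl⟩
        (length_mem_of_sameSum (l' := [4, 4, 1, 1, 1, 1, 1, 1]) (by decide +kernel))
        (length_mem_of_sameSum (l' := [19, 27, 14, 1, 1]) (by decide +kernel)),
        show (i - 1) * 2 + 4 = M - m + 2 by omega]
    · refine ⟨i • atomSum [14, 15] + atomSum [19, 27, 14], sum_nsmul_add _ _ _, ?_⟩
      rw [lengthSet_fourfold_add (a := 3) _ (by omega) (by rw [weight_atomSum]; decide +kernel)
        (by rw [weight_atomSum]; decide +kernel) (by rw [weight_atomSum]; decide +kernel)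
        ⟨_, rfl, rfl⟩
        (length_mem_of_sameSum (l' := [4, 4, 1, 1, 1, 1]) (by decide +kernel))
        ⟨_, rfl, rfl⟩,
        show i * 2 + 3 = M - m + 2 by omega]
  have := shift_mem hA (2 * m - M - 2)
  rw [key, shift, Set.image_union, Set.image_singleton, ← shift, shift_Icc] at this
  rwa [show 2 * m - M - 2 + (M - m + 2) = m by omega,
    show 2 * m - M - 2 + (2 * (M - m + 2) - 2) = M by omega,
    show 2 * m - M - 2 + 2 * (M - m + 2) = M + 2 by omega] at this

theorem theorem4p7 :
    groupSystemOfSetsOfLengths (ZMod 2 × ZMod 4) =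
        family1 ∪ family2 ∪ family3 ∪ family4 ∪ family5 ∧
      family2 = family2' := by
  refine ⟨Set.Subset.antisymm ?_ ?_, family2_eq⟩
  · rintro _ ⟨a, rfl⟩
    rw [setOfLengths_eq]
    exact lengthSet_mem a.2
  · rintro L ((((⟨y, rfl⟩ | h) | h) | h) | h)
    · exact singleton_mem y
    · exact family2_mem h
    · exact family3_mem h
    · exact family4_mem h
    · exact family5_mem h
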